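/- Let $N\ge 1$. For a (Lebesgue) measurable set $F\subset\mathbb{R}^N$ let $|F|$ be its Lebesgue measure and $P(F)=\sup\{\int_F \operatorname{div}X\,dx : X\in C^1_c(\mathbb{R}^N;\mathbb{R}^N),\ |X|\le 1\}\in[0,\infty]$ its perimeter. For a bounded measurable set $E\subset\mathbb{R}^N$ with topological boundary $\partial E$ let $d_E(x)=\operatorname{dist}(x,E)-\operatorname{dist}(x,\mathbb{R}^N\setminus E)$ and $\mathcal D(F,E)=\int_{E\Delta F}\operatorname{dist}(x,\partial E)\,dx$. **Proposition.** Let $m,M,h>0$. There exists $\Lambda_0=\Lambda_0(m,M,h,N)>0$ such that for every bounded measurable set $E\subset\mathbb{R}^N$ with $|E|=m$ and $P(E)\le M$, and for every $\Lambda\ge\Lambda_0$, the following hold. The penalized problem $$\min\Bigl\{P(F)+\tfrac1h\mathcal D(F,E)+\Lambda\bigl||F|-m\bigr| : F\subset\mathbb{R}^N \text{ measurable}\Bigr\}\qquad(1)$$ has a solution, and every solution $\overline F$ of (1) satisfies $|\overline F|=m$. In particular, (1) is equivalent to the constrained problem $$\min\Bigl\{P(F)+\tfrac1h\int_F d_E(x)\,dx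 : F\subset\mathbb{R}^N\text{ measurable},\ |F|=m\Bigr\},\qquad(2)$$ that is, a set solves (2) if and only if it solves (1); in particular (2) has a solution. -/

import Mathlib

open MeasureTheory
open scoped ENNReal symmDiff

namespace PenalizedFlow

/-- The divergence of a vector field on `ℝ^N`. -/
noncomputable def divergence {N : ℕ}
    (X : EuclideanSpace ℝ (Fin N) → EuclideanSpace ℝ (Fin N))
    (x : EuclideanSpace ℝ (Fin N)) : ℝ :=
  ∑ i : Fin N, (fderiv ℝ X x (EuclideanSpace.single i 1)) i

/-- The (De Giorgi) perimeter `P(F) ∈ [0, ∞]` of a measurable set `F ⊆ ℝ^N`: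
the supremum of `∫_F div X` over all `X ∈ C¹_c(ℝ^N; ℝ^N)` with `|X| ≤ 1` everywhere.
(`X = 0` is admissible, so truncating negative values at `0` does not change the supremum.) -/
noncomputable def perimeter {N : ℕ} (F : Set (EuclideanSpace ℝ (Fin N))) : ℝ≥0∞ :=
  ⨆ (X : EuclideanSpace ℝ (Fin N) → EuclideanSpace ℝ (Fin N))
    (_ : ContDiff ℝ 1 X) (_ : HasCompactSupport X) (_ : ∀ x, ‖X x‖ ≤ 1),
    ENNReal.ofReal (∫ x in F, divergence X x)

/-- The signed distance `d_E(x) = dist(x, E) - dist(x, ℝ^N \ E)`. -/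
noncomputable def signedDist {N : ℕ} (E : Set (EuclideanSpace ℝ (Fin N)))
    (x : EuclideanSpace ℝ (Fin N)) : ℝ :=
  Metric.infDist x E - Metric.infDist x Eᶜ

/-- The dissipation `D(F, E) = ∫_{E Δ F} dist(x, ∂E) dx ∈ [0, ∞]`. -/
noncomputable def dissipation {N : ℕ} (F E : Set (EuclideanSpace ℝ (Fin N))) : ℝ≥0∞ :=
  ∫⁻ x in E ∆ F, ENNReal.ofReal (Metric.infDist x (frontier E))

/-- The integral `∫_F d_E(x) dx` as an extended real number, i.e. the integral of the positive
part minus the integral of the negative part. The latter is finite when `E` is bounded, because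
`d_E` is nonnegative outside `E` and bounded on `E`. -/
noncomputable def signedDistIntegral {N : ℕ} (F E : Set (EuclideanSpace ℝ (Fin N))) : EReal :=
  ((∫⁻ x in F, ENNReal.ofReal (signedDist E x) : ℝ≥0∞) : EReal)
    - ((∫⁻ x in F, ENNReal.ofReal (-signedDist E x) : ℝ≥0∞) : EReal)

/-- The energy `P(F) + (1/h) ∫_F d_E(x) dx` of the volume-constrained problem. -/
noncomputable def constrainedEnergy {N : ℕ} (h : ℝ)
    (E F : Set (EuclideanSpace ℝ (Fin N))) : EReal :=
  ((perimeter F : ℝ≥0∞) : EReal) + ((1 / h : ℝ) : EReal) * signedDistIntegral F E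

/-- The volume defect `||F| - m| ∈ [0, ∞]`. The differences are truncated at `0`, so at most one
of the two summands is nonzero; the defect is `∞` when `|F| = ∞`. -/
noncomputable def volumeDefect {N : ℕ} (m : ℝ) (F : Set (EuclideanSpace ℝ (Fin N))) : ℝ≥0∞ :=
  (volume F - ENNReal.ofReal m) + (ENNReal.ofReal m - volume F)

/-- The penalized energy `P(F) + (1/h) D(F, E) + Λ ||F| - m| ∈ [0, ∞]`. -/
noncomputable def penalizedEnergy {N : ℕ} (m h Λ : ℝ)
    (E F : Set (EuclideanSpace ℝ (Fin N))) : ℝ≥0∞ :=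
  perimeter F + ENNReal.ofReal (1 / h) * dissipation F E
    + ENNReal.ofReal Λ * volumeDefect m F

/-- `F` solves `min { P(G) + (1/h) ∫_G d_E : G measurable, |G| = m }`
(measurable means Lebesgue measurable). -/
def IsConstrainedMinimizer {N : ℕ} (m h : ℝ) (E F : Set (EuclideanSpace ℝ (Fin N))) : Prop :=
  NullMeasurableSet F volume ∧ volume F = ENNReal.ofReal m ∧
    ∀ G : Set (EuclideanSpace ℝ (Fin N)), NullMeasurableSet G volume →
      volume G = ENNReal.ofReal m → constrainedEnergy h E F ≤ constrainedEnergy h E G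

/-- `F` solves `min { P(G) + (1/h) D(G, E) + Λ ||G| - m| : G ⊆ ℝ^N measurable }`
(measurable means Lebesgue measurable). -/
def IsPenalizedMinimizer {N : ℕ} (m h Λ : ℝ) (E F : Set (EuclideanSpace ℝ (Fin N))) : Prop :=
  NullMeasurableSet F volume ∧
    ∀ G : Set (EuclideanSpace ℝ (Fin N)), NullMeasurableSet G volume →
      penalizedEnergy m h Λ E F ≤ penalizedEnergy m h Λ E G

end PenalizedFlow

namespace PenalizedFlow

open Filter Topology Set

variable {N : ℕ}

theorem perimeter_congr {F G : Set (EuclideanSpace ℝ (Fin N))} (h : F =ᵐ[volume] G) :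
    perimeter F = perimeter G := by
  unfold perimeter
  simp only [setIntegral_congr_set h]

theorem dissipation_congr {F G : Set (EuclideanSpace ℝ (Fin N))} (h : F =ᵐ[volume] G)
    (E : Set (EuclideanSpace ℝ (Fin N))) : dissipation F E = dissipation G E :=
  setLIntegral_congr (ae_eq_set_symmDiff (ae_eq_refl E) h)

theorem penalizedEnergy_congr {F G : Set (EuclideanSpace ℝ (Fin N))} (h : F =ᵐ[volume] G)
    (m τ Λ : ℝ) (E : Set (EuclideanSpace ℝ (Fin N))) :
    penalizedEnergy m τ Λ E F = penalizedEnergy m τ Λ E G := by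
  unfold penalizedEnergy volumeDefect
  rw [perimeter_congr h, dissipation_congr h, measure_congr h]

theorem continuous_divergence {X : EuclideanSpace ℝ (Fin N) → EuclideanSpace ℝ (Fin N)}
    (hX : ContDiff ℝ 1 X) : Continuous (divergence X) := by
  unfold divergence
  have h1 := hX.continuous_fderiv one_ne_zero
  refine continuous_finsetSum _ fun i _ => ?_
  exact (EuclideanSpace.proj (𝕜 := ℝ) i).continuous.comp (h1.clm_apply continuous_const)

theorem hasCompactSupport_divergence
    {X : EuclideanSpace ℝ (Fin N) → EuclideanSpace ℝ (Fin N)}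
    (hX : HasCompactSupport X) : HasCompactSupport (divergence X) := by
  refine (hX.fderiv ℝ).mono' fun x hx => ?_
  by_contra h
  apply hx
  simp [divergence, image_eq_zero_of_notMem_tsupport h]

theorem integrable_divergence {X : EuclideanSpace ℝ (Fin N) → EuclideanSpace ℝ (Fin N)}
    (hX : ContDiff ℝ 1 X) (hc : HasCompactSupport X) : Integrable (divergence X) :=
  (continuous_divergence hX).integrable_of_hasCompactSupport (hasCompactSupport_divergence hc)

theorem divergence_const_smul {X : EuclideanSpace ℝ (Fin N) → EuclideanSpace ℝ (Fin N)}
    (hX : Differentiable ℝ X) (c : ℝ) (x : EuclideanSpace ℝ (Fin N)) :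
    divergence (fun y => c • X y) x = c * divergence X x := by
  unfold divergence
  rw [fderiv_fun_const_smul (hX x), Finset.mul_sum]
  simp

theorem integral_divergence_le {F : Set (EuclideanSpace ℝ (Fin N))} (hF : perimeter F ≠ ∞)
    {X : EuclideanSpace ℝ (Fin N) → EuclideanSpace ℝ (Fin N)} (hX : ContDiff ℝ 1 X)
    (hc : HasCompactSupport X) {c : ℝ} (h0 : 0 < c) (hb : ∀ x, ‖X x‖ ≤ c) :
    ∫ x in F, divergence X x ≤ c * (perimeter F).toReal := by
  have key : ENNReal.ofReal (∫ x in F, divergence (fun y => c⁻¹ • X y) x) ≤ perimeter F := by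
    unfold perimeter
    refine le_iSup_of_le (fun y => c⁻¹ • X y) <| le_iSup_of_le (hX.const_smul _) <|
      le_iSup_of_le (hc.smul_left (f := fun _ => c⁻¹)) <| le_iSup_of_le (fun x => ?_) le_rfl
    rw [norm_smul, norm_inv, Real.norm_of_nonneg h0.le]
    exact (inv_mul_le_one₀ h0).2 (hb x)
  simp_rw [divergence_const_smul (hX.differentiable one_ne_zero)] at key
  rw [integral_const_mul] at key
  have := (ENNReal.ofReal_le_iff_le_toReal hF).1 key
  rwa [inv_mul_le_iff₀ h0] at this

theorem perimeter_le_of_forall {F : Set (EuclideanSpace ℝ (Fin N))} {c : ℝ}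
    (h : ∀ X : EuclideanSpace ℝ (Fin N) → EuclideanSpace ℝ (Fin N), ContDiff ℝ 1 X →
      HasCompactSupport X → (∀ x, ‖X x‖ ≤ 1) → ∫ x in F, divergence X x ≤ c) :
    perimeter F ≤ ENNReal.ofReal c := by
  unfold perimeter
  exact iSup_le fun X => iSup_le fun h1 => iSup_le fun h2 => iSup_le fun h3 =>
    ENNReal.ofReal_le_ofReal (h X h1 h2 h3)

theorem divergence_smul {f : EuclideanSpace ℝ (Fin N) → ℝ}
    {X : EuclideanSpace ℝ (Fin N) → EuclideanSpace ℝ (Fin N)} {x : EuclideanSpace ℝ (Fin N)}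
    (hf : DifferentiableAt ℝ f x) (hX : DifferentiableAt ℝ X x) :
    divergence (fun y => f y • X y) x = f x * divergence X x + fderiv ℝ f x (X x) := by
  have hx : X x = ∑ i, X x i • EuclideanSpace.single i (1 : ℝ) := by
    ext j
    simp [Pi.single_apply]
  conv_rhs => rw [hx]
  unfold divergence
  rw [fderiv_fun_smul hf hX, map_sum, Finset.mul_sum, ← Finset.sum_add_distrib]
  simp [mul_comm]

theorem divergence_smul_const {f : EuclideanSpace ℝ (Fin N) → ℝ}
    {x : EuclideanSpace ℝ (Fin N)} (hf : DifferentiableAt ℝ f x) (v : EuclideanSpace ℝ (Fin N)) :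
    divergence (fun y => f y • v) x = fderiv ℝ f x v := by
  rw [divergence_smul hf (differentiableAt_const v)]
  simp [divergence]

theorem integral_sub_integral_translate_le {F : Set (EuclideanSpace ℝ (Fin N))}
    (hFv : volume F ≠ ∞) (hP : perimeter F ≠ ∞) {φ : EuclideanSpace ℝ (Fin N) → ℝ}
    (hφ : ContDiff ℝ 1 φ) (hc : HasCompactSupport φ) (hb : ∀ x, |φ x| ≤ 1)
    (z : EuclideanSpace ℝ (Fin N)) :
    (∫ x in F, φ x) - ∫ x in F, φ (x + z) ≤ ‖z‖ * (perimeter F).toReal := by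
  rcases eq_or_ne z 0 with rfl | hz
  · simp
  have : IsFiniteMeasure (volume.restrict F) :=
    ⟨by rw [Measure.restrict_apply_univ]; exact hFv.lt_top⟩
  have hsh : ∀ s : ℝ, ContDiff ℝ 1 (fun x => φ (x + s • z)) := fun s =>
    hφ.comp (contDiff_id.add contDiff_const)
  have hcs : ∀ s : ℝ, HasCompactSupport (fun x => φ (x + s • z)) := fun s =>
    hc.comp_homeomorph (Homeomorph.addRight (s • z))
  have hfd : ∀ (s : ℝ) x, fderiv ℝ (fun x => φ (x + s • z)) x = fderiv ℝ φ (x + s • z) :=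
    fun s x => fderiv_comp_add_right (s • z)
  obtain ⟨B, hB⟩ := (hc.fderiv ℝ).exists_bound_of_continuous (hφ.continuous_fderiv one_ne_zero)
  have hd : ∀ s : ℝ, HasDerivAt (fun s : ℝ => ∫ x in F, φ (x + s • z))
      (∫ x in F, fderiv ℝ φ (x + s • z) z) s := by
    intro s
    refine (hasDerivAt_integral_of_dominated_loc_of_deriv_le (bound := fun _ => B * ‖z‖)
      (F := fun (s : ℝ) x => φ (x + s • z))
      (F' := fun (s : ℝ) x => fderiv ℝ φ (x + s • z) z) univ_mem
      (.of_forall fun s => (hsh s).continuous.aestronglyMeasurable)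
      ((hsh s).continuous.integrable_of_hasCompactSupport (hcs s)).integrableOn
      ?_ (.of_forall fun x t _ => ?_) (integrable_const _) (.of_forall fun x t _ => ?_)).2
    · refine Continuous.aestronglyMeasurable ?_
      exact ((hφ.continuous_fderiv one_ne_zero).comp (by fun_prop)).clm_apply continuous_const
    · exact (ContinuousLinearMap.le_opNorm _ _).trans
        (mul_le_mul_of_nonneg_right (hB _) (norm_nonneg _))
    · have h1 : HasDerivAt (fun t : ℝ => x + t • z) z t := by
        simpa using ((hasDerivAt_id t).smul_const z).const_add x
      exact ((hφ.differentiable one_ne_zero) _).hasFDerivAt.comp_hasDerivAt t h1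
  have hle : ∀ s : ℝ, deriv (fun s : ℝ => -∫ x in F, φ (x + s • z)) s ≤
      ‖z‖ * (perimeter F).toReal := by
    intro s
    have := integral_divergence_le hP (X := fun y => φ (y + s • z) • (-z))
      ((hsh s).smul contDiff_const) ((hcs s).smul_right) (norm_pos_iff.2 hz) (fun x => by
        rw [norm_smul, norm_neg, Real.norm_eq_abs]
        exact mul_le_of_le_one_left (norm_nonneg _) (hb _))
    rw [(hd s).fun_neg.deriv, ← integral_neg]
    convert this using 2
    funext x
    rw [divergence_smul_const ((hsh s).differentiable one_ne_zero x), hfd, map_neg]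
  have := image_sub_le_mul_sub_of_deriv_le
    (fun s => (hd s).fun_neg.differentiableAt) hle zero_le_one
  simp only [one_smul, zero_smul, add_zero, sub_zero, mul_one] at this
  linarith

theorem exists_contDiff_bump {K U : Set (EuclideanSpace ℝ (Fin N))} (hK : IsCompact K)
    (hU : IsOpen U) (hKU : K ⊆ U) : ∃ φ : EuclideanSpace ℝ (Fin N) → ℝ, ContDiff ℝ 1 φ ∧
      HasCompactSupport φ ∧ (∀ x, 0 ≤ φ x) ∧ (∀ x, φ x ≤ 1) ∧ (∀ x ∈ K, φ x = 1) ∧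
      ∀ x ∉ U, φ x = 0 := by
  obtain ⟨L, hL, hKL, hLU⟩ := exists_compact_between hK hU hKU
  obtain ⟨f, h0, h1, h01⟩ := exists_contMDiffMap_zero_one_of_isClosed
    (n := 1) (modelWithCornersSelf ℝ (EuclideanSpace ℝ (Fin N)))
    (isOpen_interior (s := L)).isClosed_compl hK.isClosed
    (disjoint_left.2 fun x hx hxK => hx (hKL hxK))
  refine ⟨f, f.contMDiff.contDiff, ?_, fun x => (h01 x).1, fun x => (h01 x).2,
    fun x hx => h1 hx, fun x hx => h0 fun h => hx (hLU (interior_subset h))⟩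
  exact HasCompactSupport.intro hL fun x hx => h0 fun h => hx (interior_subset h)

theorem volume_diff_translate_le {F : Set (EuclideanSpace ℝ (Fin N))} (hF : MeasurableSet F)
    (hFv : volume F ≠ ∞) (hP : perimeter F ≠ ∞) (z : EuclideanSpace ℝ (Fin N)) :
    volume (F \ (fun x => x + z) ⁻¹' F) ≤ ENNReal.ofReal (‖z‖ * (perimeter F).toReal) := by
  set G := (fun x => x + z) ⁻¹' F with hG
  have hGm : MeasurableSet G := hF.preimage (measurable_add_const z)
  rw [(hF.diff hGm).measure_eq_iSup_isCompact_of_ne_top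
    (measure_ne_top_of_subset sdiff_subset hFv)]
  refine iSup_le fun K => iSup_le fun hKA => iSup_le fun hK => ?_
  refine ENNReal.le_of_forall_pos_le_add fun ε hε _ => ?_
  obtain ⟨U, hKU, hU, hUε⟩ := K.exists_isOpen_lt_add (hK.measure_lt_top (μ := volume)).ne
    (ENNReal.coe_ne_zero.2 hε.ne')
  obtain ⟨φ, hφ, hc, hφ0, hφ1, hφK, hφU⟩ := exists_contDiff_bump hK hU hKU
  have hi : Integrable φ := hφ.continuous.integrable_of_hasCompactSupport hc
  have key := integral_sub_integral_translate_le hFv hP hφ hc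
    (fun x => by rw [abs_of_nonneg (hφ0 x)]; exact hφ1 x) (-z)
  have hGi : ∫ x in F, φ (x + -z) = ∫ x in G, φ x := by
    rw [← integral_indicator hF, ← integral_indicator hGm,
      ← integral_add_right_eq_self (F.indicator fun x => φ (x + -z)) z]
    congr 1
    funext x
    by_cases h : x + z ∈ F
    · rw [indicator_of_mem h, indicator_of_mem (show x ∈ G from h)]; simp
    · rw [indicator_of_notMem h, indicator_of_notMem (show x ∉ G from h)]
  rw [hGi, norm_neg] at key
  have hKm : MeasurableSet K := hK.measurableSet
  have hKF : K ⊆ F := fun x hx => (hKA hx).1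
  have hUK : volume (U \ K) ≠ ∞ := measure_ne_top_of_subset sdiff_subset (hUε.ne_top)
  have h1 : ∫ x in G, φ x ≤ (∫ x in F \ K, φ x) + volume.real (U \ K) := by
    have e1 : ∫ x in G, φ x = (∫ x in G ∩ F, φ x) + ∫ x in G \ F, φ x :=
      (integral_inter_add_sdiff hF hi.integrableOn).symm
    have e2 : ∫ x in G ∩ F, φ x ≤ ∫ x in F \ K, φ x :=
      setIntegral_mono_set hi.integrableOn (.of_forall hφ0)
        (LE.le.eventuallyLE fun x hx => ⟨hx.2, fun hK' => (hKA hK').2 hx.1⟩)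
    have e3 : ∫ x in G \ F, φ x ≤ ∫ x in U \ K, (1 : ℝ) := by
      rw [← integral_indicator (hGm.diff hF), ← integral_indicator (hU.measurableSet.diff hKm)]
      refine integral_mono_of_nonneg
        (.of_forall fun x => indicator_nonneg (fun x _ => hφ0 x) x)
        ((integrable_indicator_iff (hU.measurableSet.diff hKm)).2 (integrableOn_const hUK))
        (.of_forall fun x => ?_)
      by_cases hx : x ∈ U \ K
      · simp only [indicator_of_mem hx]
        exact indicator_le' (fun x _ => hφ1 x) (fun x _ => zero_le_one) x
      · simp only [indicator_of_notMem hx]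
        by_cases hx' : x ∈ G \ F
        · rw [indicator_of_mem hx', hφU x fun h => hx ⟨h, fun h' => hx'.2 (hKF h')⟩]
        · rw [indicator_of_notMem hx']
    rw [setIntegral_const, smul_eq_mul, mul_one] at e3
    linarith
  have h2 : ∫ x in F, φ x = volume.real K + ∫ x in F \ K, φ x := by
    rw [← integral_inter_add_sdiff hKm hi.integrableOn, inter_eq_self_of_subset_right hKF,
      setIntegral_congr_fun hKm (g := fun _ => (1 : ℝ)) (fun x hx => hφK x hx)]
    simp
  have h3 : volume.real (U \ K) ≤ ε := by
    refine ENNReal.toReal_le_coe_of_le_coe ?_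
    rw [measure_sdiff hKU hKm.nullMeasurableSet hK.measure_lt_top.ne]
    exact tsub_le_iff_left.2 hUε.le
  have h4 : volume.real K ≤ ‖z‖ * (perimeter F).toReal + ε := by linarith
  have h5 := ENNReal.ofReal_le_ofReal h4
  rwa [measureReal_def, ENNReal.ofReal_toReal hK.measure_lt_top.ne,
    ENNReal.ofReal_add (by positivity) ε.coe_nonneg, ENNReal.ofReal_coe_nnreal] at h5

theorem setLIntegral_volume_ball_diff_le {F : Set (EuclideanSpace ℝ (Fin N))}
    (hF : MeasurableSet F) (hFv : volume F ≠ ∞) (hP : perimeter F ≠ ∞) (r : ℝ) :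
    ∫⁻ x in F, volume (Metric.ball x r \ F) ≤
      volume (Metric.ball (0 : EuclideanSpace ℝ (Fin N)) r) *
        ENNReal.ofReal (r * (perimeter F).toReal) := by
  set B := Metric.ball (0 : EuclideanSpace ℝ (Fin N)) r with hB
  set S : Set (EuclideanSpace ℝ (Fin N) × EuclideanSpace ℝ (Fin N)) :=
    {p | p.1 + p.2 ∉ F} with hS
  have hSm : MeasurableSet S := (hF.preimage (measurable_fst.add measurable_snd)).compl
  have e1 : ∀ x, volume (Metric.ball x r \ F) =
      ∫⁻ z in B, S.indicator (fun _ => (1 : ℝ≥0∞)) (x, z) := by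
    intro x
    have : (fun z => S.indicator (fun _ => (1 : ℝ≥0∞)) (x, z)) =
        (Prod.mk x ⁻¹' S).indicator (fun _ => 1) := rfl
    rw [this, lintegral_indicator (measurable_prodMk_left hSm), setLIntegral_one,
      Measure.restrict_apply (measurable_prodMk_left hSm),
      ← measure_preimage_add volume x (Metric.ball x r \ F)]
    congr 1
    ext z
    simp [hB, hS, and_comm]
  calc ∫⁻ x in F, volume (Metric.ball x r \ F)
      = ∫⁻ z in B, ∫⁻ x in F, S.indicator (fun _ => (1 : ℝ≥0∞)) (x, z) := by
        simp_rw [e1]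
        exact lintegral_lintegral_swap (measurable_const.indicator hSm).aemeasurable
    _ ≤ ∫⁻ z in B, ENNReal.ofReal (r * (perimeter F).toReal) := by
        refine setLIntegral_mono measurable_const fun z hz => ?_
        have : (fun x => S.indicator (fun _ => (1 : ℝ≥0∞)) (x, z)) =
          ((fun x => (x, z)) ⁻¹' S).indicator (fun _ => 1) := rfl
        rw [this, lintegral_indicator (measurable_prodMk_right hSm), setLIntegral_one,
          Measure.restrict_apply (measurable_prodMk_right hSm)]
        have e2 : (fun x => (x, z)) ⁻¹' S ∩ F = F \ (fun x => x + z) ⁻¹' F := by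
          ext x; simp [hS, and_comm]
        rw [e2]
        refine (volume_diff_translate_le hF hFv hP z).trans (ENNReal.ofReal_le_ofReal ?_)
        have : ‖z‖ ≤ r := by simpa [hB] using (mem_ball_zero_iff.1 hz).le
        gcongr
    _ = _ := by rw [setLIntegral_const, mul_comm]

theorem exists_ball_half_le {F : Set (EuclideanSpace ℝ (Fin N))}
    (hF : MeasurableSet F) (hFv : volume F ≠ ∞) (hP : perimeter F ≠ ∞) {r : ℝ} (hr : 0 < r)
    (h : 2 * r * (perimeter F).toReal < volume.real F) :
    ∃ x, volume.real (Metric.ball (0 : EuclideanSpace ℝ (Fin N)) r) / 2 ≤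
      volume.real (F ∩ Metric.ball x r) := by
  by_contra! hcon
  set b := volume.real (Metric.ball (0 : EuclideanSpace ℝ (Fin N)) r) with hb
  have hball : ∀ x : EuclideanSpace ℝ (Fin N), volume.real (Metric.ball x r) = b := fun x => by
    rw [hb, measureReal_def, measureReal_def, Measure.addHaar_ball_center]
  have hb0 : 0 < b := ENNReal.toReal_pos (Metric.measure_ball_pos _ _ hr).ne'
    measure_ball_lt_top.ne
  have h1 := setLIntegral_volume_ball_diff_le hF hFv hP r
  have h2 : ∫⁻ x in F, ENNReal.ofReal (b / 2) ≤ ∫⁻ x in F, volume (Metric.ball x r \ F) := by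
    refine lintegral_mono fun x => ?_
    have e := measureReal_sdiff_add_inter (μ := volume) (s := Metric.ball x r) hF
      measure_ball_lt_top.ne
    rw [inter_comm, hball] at e
    refine ENNReal.ofReal_le_of_le_toReal ?_
    have := hcon x
    rw [← measureReal_def]
    linarith
  have h3 := h2.trans h1
  rw [setLIntegral_const, ← ENNReal.ofReal_toReal hFv,
    ← ENNReal.ofReal_toReal (measure_ball_lt_top (μ := volume)
      (x := (0 : EuclideanSpace ℝ (Fin N))) (r := r)).ne, ← measureReal_def, ← measureReal_def,
    ← ENNReal.ofReal_mul (by positivity), ← ENNReal.ofReal_mul (by positivity),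
    ENNReal.ofReal_le_ofReal_iff (by positivity), ← hb] at h3
  nlinarith

/-- The map stretching `ℝ^N` in the direction of the `i`-th coordinate by the displacement `θ`. -/
noncomputable def stretch (i : Fin N) (θ : ℝ → ℝ) (x : EuclideanSpace ℝ (Fin N)) :
    EuclideanSpace ℝ (Fin N) :=
  x + θ (x i) • EuclideanSpace.single i 1

theorem dist_stretch_le (i : Fin N) {θ : ℝ → ℝ} {C : ℝ} (hC : ∀ s, |θ s| ≤ C)
    (x : EuclideanSpace ℝ (Fin N)) : dist (stretch i θ x) x ≤ C := by
  simpa [stretch, dist_eq_norm, norm_smul] using hC (x i)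

theorem contDiff_comp_coord {n : WithTop ℕ∞} (i : Fin N) {g : ℝ → ℝ} (hg : ContDiff ℝ n g) :
    ContDiff ℝ n (fun x : EuclideanSpace ℝ (Fin N) => g (x i)) :=
  hg.comp (EuclideanSpace.proj (𝕜 := ℝ) i).contDiff

theorem contDiff_stretch {n : WithTop ℕ∞} (i : Fin N) {θ : ℝ → ℝ} (hθ : ContDiff ℝ n θ) :
    ContDiff ℝ n (stretch i θ) :=
  contDiff_id.add ((contDiff_comp_coord i hθ).smul contDiff_const)

theorem hasFDerivAt_comp_coord (i : Fin N) {g : ℝ → ℝ} (hg : Differentiable ℝ g)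
    (x : EuclideanSpace ℝ (Fin N)) :
    HasFDerivAt (fun x : EuclideanSpace ℝ (Fin N) => g (x i))
      (deriv g (x i) • (EuclideanSpace.proj i : EuclideanSpace ℝ (Fin N) →L[ℝ] ℝ)) x :=
  (hg (x i)).hasDerivAt.comp_hasFDerivAt x
    (EuclideanSpace.proj i : EuclideanSpace ℝ (Fin N) →L[ℝ] ℝ).hasFDerivAt

/-- The derivative of `stretch i θ` at a point where `θ'` takes the value `c`. -/
noncomputable def stretchDeriv (i : Fin N) (c : ℝ) :
    EuclideanSpace ℝ (Fin N) →L[ℝ] EuclideanSpace ℝ (Fin N) :=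
  .id ℝ _ + (c • (EuclideanSpace.proj i : EuclideanSpace ℝ (Fin N) →L[ℝ] ℝ)).smulRight
    (EuclideanSpace.single i 1)

theorem stretchDeriv_apply (i : Fin N) (c : ℝ) (v : EuclideanSpace ℝ (Fin N)) :
    stretchDeriv i c v = v + (c * v i) • EuclideanSpace.single i (1 : ℝ) := by
  simp [stretchDeriv]

theorem hasFDerivAt_stretch (i : Fin N) {θ : ℝ → ℝ} (hθ : Differentiable ℝ θ)
    (x : EuclideanSpace ℝ (Fin N)) :
    HasFDerivAt (stretch i θ) (stretchDeriv i (deriv θ (x i))) x :=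
  (hasFDerivAt_id x).add ((hasFDerivAt_comp_coord i hθ x).smul_const _)

theorem det_stretchDeriv (i : Fin N) (c : ℝ) : (stretchDeriv i c).det = 1 + c := by
  have : ((stretchDeriv i c : EuclideanSpace ℝ (Fin N) →L[ℝ] EuclideanSpace ℝ (Fin N)) :
      EuclideanSpace ℝ (Fin N) →ₗ[ℝ] EuclideanSpace ℝ (Fin N)) =
      LinearMap.transvection
        (c • (EuclideanSpace.proj i : EuclideanSpace ℝ (Fin N) →L[ℝ] ℝ) :
          EuclideanSpace ℝ (Fin N) →L[ℝ] ℝ).toLinearMap (EuclideanSpace.single i 1) := by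
    ext v : 1
    simp [stretchDeriv, LinearMap.transvection.apply]
  rw [ContinuousLinearMap.det, this, LinearMap.transvection.det]
  simp

theorem injective_stretch (i : Fin N) {θ : ℝ → ℝ} (hθ : Differentiable ℝ θ)
    (hb : ∀ s, |deriv θ s| ≤ 1 / 2) : Function.Injective (stretch i θ) := by
  intro x y h
  have h1 : x - y = (θ (y i) - θ (x i)) • EuclideanSpace.single i (1 : ℝ) := by
    unfold stretch at h
    rw [sub_smul, sub_eq_sub_iff_add_eq_add, add_comm _ y]
    exact h
  have h2 : x i - y i = θ (y i) - θ (x i) := by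
    simpa using congrArg (fun v : EuclideanSpace ℝ (Fin N) => v i) h1
  have h3 : ‖θ (y i) - θ (x i)‖ ≤ 1 / 2 * ‖y i - x i‖ :=
    convex_univ.norm_image_sub_le_of_norm_deriv_le (fun s _ => hθ s) (fun s _ => hb s)
      (mem_univ _) (mem_univ _)
  rw [← h2, norm_sub_rev (y i)] at h3
  have h4 : ‖x i - y i‖ = 0 := le_antisymm (by linarith) (norm_nonneg _)
  rw [← h2, norm_eq_zero.1 h4, zero_smul] at h1
  exact sub_eq_zero.1 h1

theorem measurableSet_image_stretch (i : Fin N) {θ : ℝ → ℝ} (hθ : Differentiable ℝ θ)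
    (hb : ∀ s, |deriv θ s| ≤ 1 / 2) {F : Set (EuclideanSpace ℝ (Fin N))}
    (hF : MeasurableSet F) : MeasurableSet (stretch i θ '' F) :=
  measurable_image_of_fderivWithin hF
    (fun x _ => (hasFDerivAt_stretch i hθ x).hasFDerivWithinAt)
    (injective_stretch i hθ hb).injOn

theorem setIntegral_image_stretch (i : Fin N) {θ : ℝ → ℝ} (hθ : Differentiable ℝ θ)
    (hb : ∀ s, |deriv θ s| ≤ 1 / 2) {F : Set (EuclideanSpace ℝ (Fin N))}
    (hF : MeasurableSet F) (g : EuclideanSpace ℝ (Fin N) → ℝ) :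
    ∫ x in stretch i θ '' F, g x = ∫ x in F, (1 + deriv θ (x i)) * g (stretch i θ x) := by
  rw [integral_image_eq_integral_abs_det_fderiv_smul volume hF
    (fun x _ => (hasFDerivAt_stretch i hθ x).hasFDerivWithinAt) (injective_stretch i hθ hb).injOn]
  congr 1
  funext x
  have := abs_le.1 (hb (x i))
  rw [det_stretchDeriv, abs_of_nonneg (by linarith), smul_eq_mul]

theorem integrableOn_image_stretch (i : Fin N) {θ : ℝ → ℝ} (hθ : Differentiable ℝ θ)
    (hb : ∀ s, |deriv θ s| ≤ 1 / 2) {F : Set (EuclideanSpace ℝ (Fin N))}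
    (hF : MeasurableSet F) {g : EuclideanSpace ℝ (Fin N) → ℝ} :
    IntegrableOn g (stretch i θ '' F) ↔
      IntegrableOn (fun x => (1 + deriv θ (x i)) * g (stretch i θ x)) F := by
  rw [integrableOn_image_iff_integrableOn_abs_det_fderiv_smul volume hF
    (fun x _ => (hasFDerivAt_stretch i hθ x).hasFDerivWithinAt) (injective_stretch i hθ hb).injOn]
  have : ∀ x : EuclideanSpace ℝ (Fin N),
      |(stretchDeriv i (deriv θ (x i))).det| = 1 + deriv θ (x i) := fun x => by
    have := abs_le.1 (hb (x i))
    rw [det_stretchDeriv, abs_of_nonneg (by linarith)]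
  simp_rw [this, smul_eq_mul]

theorem divergence_stretch_field (i : Fin N) {θ : ℝ → ℝ} (hθ : ContDiff ℝ 2 θ)
    {X : EuclideanSpace ℝ (Fin N) → EuclideanSpace ℝ (Fin N)} (hX : ContDiff ℝ 1 X)
    (x : EuclideanSpace ℝ (Fin N)) :
    divergence (fun y => (1 + deriv θ (y i)) • X (stretch i θ y)
      - (deriv θ (y i) * X (stretch i θ y) i) • EuclideanSpace.single i (1 : ℝ)) x =
      (1 + deriv θ (x i)) * divergence X (stretch i θ x) := by
  have hθd : Differentiable ℝ θ := hθ.differentiable two_ne_zero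
  have hθ' : ContDiff ℝ 1 (deriv θ) := ((contDiff_succ_iff_deriv (n := 1)).1 hθ).2.2
  have hg := hasFDerivAt_comp_coord i (hθ'.differentiable one_ne_zero) x
  set L := fderiv ℝ X (stretch i θ x) with hL
  have hXs : HasFDerivAt (fun y => X (stretch i θ y))
      (L.comp (stretchDeriv i (deriv θ (x i)))) x :=
    ((hX.differentiable one_ne_zero) _).hasFDerivAt.comp x (hasFDerivAt_stretch i hθd x)
  have hXi : HasFDerivAt (fun y => X (stretch i θ y) i)
      ((EuclideanSpace.proj i : EuclideanSpace ℝ (Fin N) →L[ℝ] ℝ).comp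
        (L.comp (stretchDeriv i (deriv θ (x i))))) x :=
    (EuclideanSpace.proj i : EuclideanSpace ℝ (Fin N) →L[ℝ] ℝ).hasFDerivAt.comp x hXs
  have hsub : ∀ {A B : EuclideanSpace ℝ (Fin N) → EuclideanSpace ℝ (Fin N)},
      DifferentiableAt ℝ A x → DifferentiableAt ℝ B x →
      divergence (fun y => A y - B y) x = divergence A x - divergence B x := by
    intro A B hA hB
    unfold divergence
    rw [fderiv_fun_sub hA hB, ← Finset.sum_sub_distrib]
    simp
  have hdiv : divergence (fun y => X (stretch i θ y)) x =
      divergence X (stretch i θ x) + deriv θ (x i) * (L (EuclideanSpace.single i 1)) i := by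
    unfold divergence
    rw [hXs.fderiv]
    simp only [ContinuousLinearMap.comp_apply, stretchDeriv_apply, map_add, map_smul,
      PiLp.add_apply, PiLp.smul_apply, Finset.sum_add_distrib, ← hL, smul_eq_mul]
    congr 1
    simp
  have hmul := hg.fun_mul hXi
  rw [hsub ((hg.const_add 1).differentiableAt.fun_smul hXs.differentiableAt)
    (hmul.differentiableAt.smul_const _),
    divergence_smul (hg.const_add 1).differentiableAt hXs.differentiableAt,
    divergence_smul_const hmul.differentiableAt, hdiv, (hg.const_add 1).fderiv, hmul.fderiv]
  simp [stretchDeriv_apply]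
  ring

theorem perimeter_image_stretch_le (i : Fin N) {θ : ℝ → ℝ} (hθ : ContDiff ℝ 2 θ) {κ C : ℝ}
    (hκ : κ ≤ 1 / 2) (hb : ∀ s, |deriv θ s| ≤ κ) (hC : ∀ s, |θ s| ≤ C)
    {F : Set (EuclideanSpace ℝ (Fin N))} (hF : MeasurableSet F) (hP : perimeter F ≠ ∞) :
    perimeter (stretch i θ '' F) ≤ ENNReal.ofReal ((1 + 2 * κ) * (perimeter F).toReal) := by
  have hθd : Differentiable ℝ θ := hθ.differentiable two_ne_zero
  have hθ' : ContDiff ℝ 1 (deriv θ) := ((contDiff_succ_iff_deriv (n := 1)).1 hθ).2.2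
  have hκ0 : 0 ≤ κ := (abs_nonneg _).trans (hb 0)
  refine perimeter_le_of_forall fun X hX hc hX1 => ?_
  rw [setIntegral_image_stretch i hθd (fun s => (hb s).trans hκ) hF]
  simp_rw [← divergence_stretch_field i hθ hX]
  have hXs : ContDiff ℝ 1 (fun y => X (stretch i θ y)) :=
    hX.comp (contDiff_stretch i (hθ.of_le one_le_two))
  have hw := contDiff_comp_coord i hθ' (N := N)
  refine integral_divergence_le hP ?_ ?_ (by positivity) fun x => ?_
  · exact ((contDiff_const.add hw).smul hXs).sub
      ((hw.mul ((EuclideanSpace.proj (𝕜 := ℝ) i).contDiff.comp hXs)).smul contDiff_const)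
  · obtain ⟨R, hR⟩ := hc.isCompact.isBounded.subset_closedBall 0
    refine HasCompactSupport.intro (isCompact_closedBall 0 (R + C)) fun x hx => ?_
    have : X (stretch i θ x) = 0 := by
      refine image_eq_zero_of_notMem_tsupport fun h => hx ?_
      have h1 := Metric.mem_closedBall.1 (hR h)
      have h2 := dist_stretch_le i hC x
      rw [Metric.mem_closedBall]
      have := dist_triangle x (stretch i θ x) 0
      rw [dist_comm x (stretch i θ x)] at this
      linarith
    simp [this]
  · refine (norm_sub_le _ _).trans ?_
    rw [norm_smul, norm_smul, norm_mul, PiLp.norm_single, norm_one, mul_one]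
    have h1 : ‖1 + deriv θ (x i)‖ ≤ 1 + κ :=
      (norm_add_le _ _).trans (by rw [norm_one]; exact add_le_add_right (hb _) _)
    have h2 : ‖X (stretch i θ x) i‖ ≤ 1 := (PiLp.norm_apply_le _ i).trans (hX1 _)
    have h3 := mul_le_mul h1 (hX1 (stretch i θ x)) (norm_nonneg _) (by positivity)
    have h4 := mul_le_mul (hb (x i)) h2 (norm_nonneg _) hκ0
    rw [← Real.norm_eq_abs] at h4
    linarith

theorem infDist_compl_eq_infDist_frontier {E : Set (EuclideanSpace ℝ (Fin N))}
    (hE : E ≠ univ) {x : EuclideanSpace ℝ (Fin N)} (hx : x ∈ E) :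
    Metric.infDist x Eᶜ = Metric.infDist x (frontier E) := by
  obtain ⟨y, hy, hxy⟩ := exists_mem_frontier_infDist_compl_eq_dist hx hE
  refine le_antisymm ?_ (hxy ▸ Metric.infDist_le_dist_of_mem hy)
  rw [← Metric.infDist_closure (s := Eᶜ)]
  refine Metric.infDist_le_infDist_of_subset ?_ ⟨y, hy⟩
  rw [frontier_eq_closure_inter_closure]
  exact inter_subset_right

theorem signedDist_of_mem {E : Set (EuclideanSpace ℝ (Fin N))}
    (hE : E ≠ univ) {x : EuclideanSpace ℝ (Fin N)} (hx : x ∈ E) :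
    signedDist E x = -Metric.infDist x (frontier E) := by
  rw [signedDist, Metric.infDist_zero_of_mem hx, infDist_compl_eq_infDist_frontier hE hx, zero_sub]

theorem signedDist_of_notMem {E : Set (EuclideanSpace ℝ (Fin N))}
    (hE : E.Nonempty) {x : EuclideanSpace ℝ (Fin N)} (hx : x ∉ E) :
    signedDist E x = Metric.infDist x (frontier E) := by
  have h := infDist_compl_eq_infDist_frontier (E := Eᶜ)
    (fun h => hE.ne_empty (compl_univ_iff.1 h)) hx
  rw [compl_compl, frontier_compl] at h
  rw [signedDist, h, Metric.infDist_zero_of_mem (show x ∈ Eᶜ from hx), sub_zero]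

theorem abs_signedDist_sub_le (E : Set (EuclideanSpace ℝ (Fin N)))
    (x y : EuclideanSpace ℝ (Fin N)) : |signedDist E x - signedDist E y| ≤ 2 * dist x y := by
  have h1 := (Metric.lipschitz_infDist_pt E).dist_le_mul x y
  have h2 := (Metric.lipschitz_infDist_pt Eᶜ).dist_le_mul x y
  rw [Real.dist_eq, NNReal.coe_one, one_mul] at h1 h2
  unfold signedDist
  rw [abs_le] at *
  constructor <;> linarith [h1.1, h1.2, h2.1, h2.2]

theorem continuous_signedDist (E : Set (EuclideanSpace ℝ (Fin N))) : Continuous (signedDist E) :=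
  (Metric.continuous_infDist_pt E).sub (Metric.continuous_infDist_pt Eᶜ)

theorem ofReal_signedDist_of_mem {E : Set (EuclideanSpace ℝ (Fin N))}
    (hE : E ≠ univ) {x : EuclideanSpace ℝ (Fin N)} (hx : x ∈ E) :
    ENNReal.ofReal (signedDist E x) = 0 := by
  rw [signedDist_of_mem hE hx, ENNReal.ofReal_eq_zero, neg_nonpos]
  exact Metric.infDist_nonneg

theorem ofReal_neg_signedDist_of_notMem {E : Set (EuclideanSpace ℝ (Fin N))}
    (hE : E.Nonempty) {x : EuclideanSpace ℝ (Fin N)} (hx : x ∉ E) :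
    ENNReal.ofReal (-signedDist E x) = 0 := by
  rw [signedDist_of_notMem hE hx, ENNReal.ofReal_eq_zero, neg_nonpos]
  exact Metric.infDist_nonneg

theorem setLIntegral_inter_add_sdiff {α : Type*} [MeasurableSpace α] {μ : Measure α}
    (f : α → ℝ≥0∞) (A : Set α) {B : Set α} (hB : NullMeasurableSet B μ) :
    (∫⁻ x in A ∩ B, f x ∂μ) + ∫⁻ x in A \ B, f x ∂μ = ∫⁻ x in A, f x ∂μ := by
  rw [← lintegral_add_measure, Measure.restrict_inter_add_sdiff₀ _ hB]

theorem setLIntegral_signedDist {E F : Set (EuclideanSpace ℝ (Fin N))} (hE0 : E.Nonempty)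
    (hE1 : E ≠ univ) (hE : NullMeasurableSet E volume) (hF : NullMeasurableSet F volume) :
    ∫⁻ x in F, ENNReal.ofReal (signedDist E x) =
      ∫⁻ x in F \ E, ENNReal.ofReal (Metric.infDist x (frontier E)) := by
  rw [← setLIntegral_inter_add_sdiff _ F hE,
    lintegral_congr_ae (g := fun _ => 0), lintegral_zero, zero_add]
  · refine lintegral_congr_ae ?_
    filter_upwards [ae_restrict_mem₀ (hF.diff hE)] with x hx
    rw [signedDist_of_notMem hE0 hx.2]
  · filter_upwards [ae_restrict_mem₀ (hF.inter hE)] with x hx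
    exact ofReal_signedDist_of_mem hE1 hx.2

theorem setLIntegral_neg_signedDist {E F : Set (EuclideanSpace ℝ (Fin N))} (hE0 : E.Nonempty)
    (hE1 : E ≠ univ) (hE : NullMeasurableSet E volume) (hF : NullMeasurableSet F volume) :
    ∫⁻ x in F, ENNReal.ofReal (-signedDist E x) =
      ∫⁻ x in F ∩ E, ENNReal.ofReal (Metric.infDist x (frontier E)) := by
  rw [← setLIntegral_inter_add_sdiff _ F hE,
    lintegral_congr_ae (μ := volume.restrict (F \ E)) (g := fun _ => 0), lintegral_zero, add_zero]
  · refine lintegral_congr_ae ?_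
    filter_upwards [ae_restrict_mem₀ (hF.inter hE)] with x hx
    rw [signedDist_of_mem hE1 hx.2, neg_neg]
  · filter_upwards [ae_restrict_mem₀ (hF.diff hE)] with x hx
    exact ofReal_neg_signedDist_of_notMem hE0 hx.2

theorem dissipation_eq_add {E F : Set (EuclideanSpace ℝ (Fin N))}
    (hE : NullMeasurableSet E volume) (hF : NullMeasurableSet F volume) :
    dissipation F E = (∫⁻ x in F \ E, ENNReal.ofReal (Metric.infDist x (frontier E))) +
      ∫⁻ x in E \ F, ENNReal.ofReal (Metric.infDist x (frontier E)) := by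
  have hd : AEDisjoint volume (E \ F) (F \ E) :=
    (disjoint_left.2 fun x h1 h2 => h1.2 h2.1).aedisjoint
  rw [dissipation, Set.symmDiff_def, Measure.restrict_union₀ hd (hF.diff hE),
    lintegral_add_measure, add_comm]

/-- The constant `∫_E dist(x, ∂E) dx`, by which the dissipation and the signed distance integral
differ. -/
noncomputable def depthIntegral (E : Set (EuclideanSpace ℝ (Fin N))) : ℝ≥0∞ :=
  ∫⁻ x in E, ENNReal.ofReal (Metric.infDist x (frontier E))

theorem setLIntegral_inter_le {E : Set (EuclideanSpace ℝ (Fin N))}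
    (hE : NullMeasurableSet E volume) {F : Set (EuclideanSpace ℝ (Fin N))}
    (hF : NullMeasurableSet F volume) {ρ : ℝ}
    (hρ : ∀ x ∈ E, Metric.infDist x (frontier E) ≤ ρ) :
    ∫⁻ x in F ∩ E, ENNReal.ofReal (Metric.infDist x (frontier E)) ≤
      ENNReal.ofReal ρ * volume F := by
  calc _ ≤ ∫⁻ x in F ∩ E, ENNReal.ofReal ρ := by
        refine lintegral_mono_ae ?_
        filter_upwards [ae_restrict_mem₀ (hF.inter hE)] with x hx
        exact ENNReal.ofReal_le_ofReal (hρ x hx.2)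
    _ ≤ _ := by
        rw [setLIntegral_const]
        gcongr
        exact inter_subset_left

theorem depthIntegral_ne_top {E : Set (EuclideanSpace ℝ (Fin N))}
    (hE : NullMeasurableSet E volume) (hEv : volume E ≠ ∞) {ρ : ℝ}
    (hρ : ∀ x ∈ E, Metric.infDist x (frontier E) ≤ ρ) : depthIntegral E ≠ ∞ := by
  have := setLIntegral_inter_le hE hE hρ
  rw [inter_self] at this
  exact ne_top_of_le_ne_top (ENNReal.mul_ne_top ENNReal.ofReal_ne_top hEv) this

theorem depthIntegral_eq_add (E : Set (EuclideanSpace ℝ (Fin N)))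
    {F : Set (EuclideanSpace ℝ (Fin N))} (hF : NullMeasurableSet F volume) :
    depthIntegral E = (∫⁻ x in F ∩ E, ENNReal.ofReal (Metric.infDist x (frontier E))) +
      ∫⁻ x in E \ F, ENNReal.ofReal (Metric.infDist x (frontier E)) := by
  rw [inter_comm F E, setLIntegral_inter_add_sdiff _ E hF, depthIntegral]

theorem toReal_dissipation {E F : Set (EuclideanSpace ℝ (Fin N))} (hE0 : E.Nonempty)
    (hE1 : E ≠ univ) (hE : NullMeasurableSet E volume) (hF : NullMeasurableSet F volume)
    (hdE : depthIntegral E ≠ ∞) (hi : IntegrableOn (signedDist E) F) :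
    dissipation F E ≠ ∞ ∧
      (dissipation F E).toReal = (∫ x in F, signedDist E x) + (depthIntegral E).toReal := by
  have e := depthIntegral_eq_add E hF
  have hA : (∫⁻ x in F \ E, ENNReal.ofReal (Metric.infDist x (frontier E))) ≠ ∞ := by
    rw [← setLIntegral_signedDist hE0 hE1 hE hF]
    refine ne_top_of_le_ne_top hi.2.ne (lintegral_mono fun x => ?_)
    exact Real.ofReal_le_enorm _
  have hB := ne_top_of_le_ne_top hdE (e ▸ le_self_add)
  have hC := ne_top_of_le_ne_top hdE (e ▸ le_add_self)
  rw [dissipation_eq_add hE hF, e]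
  refine ⟨ENNReal.add_ne_top.2 ⟨hA, hC⟩, ?_⟩
  rw [integral_eq_lintegral_pos_part_sub_lintegral_neg_part hi,
    setLIntegral_signedDist hE0 hE1 hE hF, setLIntegral_neg_signedDist hE0 hE1 hE hF,
    ENNReal.toReal_add hA hC, ENNReal.toReal_add hB hC]
  ring

theorem integrableOn_signedDist {E F : Set (EuclideanSpace ℝ (Fin N))} (hE0 : E.Nonempty)
    (hE1 : E ≠ univ) (hE : NullMeasurableSet E volume) (hF : NullMeasurableSet F volume)
    (hFv : volume F ≠ ∞) {ρ : ℝ} (hρ : ∀ x ∈ E, Metric.infDist x (frontier E) ≤ ρ)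
    (hD : dissipation F E ≠ ∞) :
    IntegrableOn (signedDist E) F ∧
      ∫ x in F, |signedDist E x| ≤ (dissipation F E).toReal + max ρ 0 * volume.real F := by
  have hm : AEStronglyMeasurable (signedDist E) (volume.restrict F) :=
    (continuous_signedDist E).aestronglyMeasurable
  have hB : ENNReal.ofReal ρ * volume F ≠ ∞ := ENNReal.mul_ne_top ENNReal.ofReal_ne_top hFv
  have key : ∫⁻ x in F, ‖signedDist E x‖ₑ ≤ dissipation F E + ENNReal.ofReal ρ * volume F := by
    have : ∀ x, ‖signedDist E x‖ₑ =
        ENNReal.ofReal (signedDist E x) + ENNReal.ofReal (-signedDist E x) := fun x => by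
      rw [← ofReal_norm, Real.norm_eq_abs]
      rcases le_total 0 (signedDist E x) with h | h
      · rw [abs_of_nonneg h, ENNReal.ofReal_of_nonpos (neg_nonpos.2 h), add_zero]
      · rw [abs_of_nonpos h, ENNReal.ofReal_of_nonpos h, zero_add]
    simp_rw [this]
    rw [lintegral_add_left (continuous_signedDist E).measurable.ennreal_ofReal,
      setLIntegral_signedDist hE0 hE1 hE hF, setLIntegral_neg_signedDist hE0 hE1 hE hF,
      dissipation_eq_add hE hF]
    exact add_le_add le_self_add (setLIntegral_inter_le hE hF hρ)
  refine ⟨⟨hm, key.trans_lt (ENNReal.add_lt_top.2 ⟨hD.lt_top, hB.lt_top⟩)⟩, ?_⟩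
  have h2 := ENNReal.toReal_mono (ENNReal.add_ne_top.2 ⟨hD, hB⟩) key
  rw [ENNReal.toReal_add hD hB, ENNReal.toReal_mul, ENNReal.toReal_ofReal'] at h2
  rw [← integral_norm_eq_lintegral_enorm hm] at h2
  exact h2

theorem dissipation_image_stretch_le {E F : Set (EuclideanSpace ℝ (Fin N))} (hE0 : E.Nonempty)
    (hE1 : E ≠ univ) (hE : NullMeasurableSet E volume) (hF : MeasurableSet F)
    (hFv : volume F ≠ ∞) {ρ : ℝ} (hρ : ∀ x ∈ E, Metric.infDist x (frontier E) ≤ ρ)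
    (hdE : depthIntegral E ≠ ∞) (hD : dissipation F E ≠ ∞)
    (i : Fin N) {θ : ℝ → ℝ} (hθ : ContDiff ℝ 1 θ) {κ C : ℝ}
    (hκ : κ ≤ 1 / 2) (hb : ∀ s, |deriv θ s| ≤ κ) (hC : ∀ s, |θ s| ≤ C) :
    dissipation (stretch i θ '' F) E ≠ ∞ ∧
    (dissipation (stretch i θ '' F) E).toReal ≤ (dissipation F E).toReal +
      (3 * C * volume.real F + κ * ((dissipation F E).toReal + max ρ 0 * volume.real F)) := by
  have hθd : Differentiable ℝ θ := hθ.differentiable one_ne_zero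
  have hb' : ∀ s, |deriv θ s| ≤ 1 / 2 := fun s => (hb s).trans hκ
  have hκ0 : 0 ≤ κ := (abs_nonneg _).trans (hb 0)
  have hC0 : 0 ≤ C := (abs_nonneg _).trans (hC 0)
  obtain ⟨hi, hle⟩ := integrableOn_signedDist hE0 hE1 hE hF.nullMeasurableSet hFv hρ hD
  have hcf : IntegrableOn (fun _ => (3 * C : ℝ)) F := integrableOn_const hFv
  have hbd : ∀ x : EuclideanSpace ℝ (Fin N),
      |(1 + deriv θ (x i)) * signedDist E (stretch i θ x) - signedDist E x| ≤
        3 * C + κ * |signedDist E x| := by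
    intro x
    have e : (1 + deriv θ (x i)) * signedDist E (stretch i θ x) - signedDist E x =
      (1 + deriv θ (x i)) * (signedDist E (stretch i θ x) - signedDist E x) +
        deriv θ (x i) * signedDist E x := by ring
    rw [e]
    refine (abs_add_le _ _).trans (add_le_add ?_ ?_)
    · rw [abs_mul]
      have h1 := abs_signedDist_sub_le E (stretch i θ x) x
      have h2 := dist_stretch_le i hC x
      have h3 : |1 + deriv θ (x i)| ≤ 3 / 2 := by
        have := abs_le.1 (hb' (x i))
        rw [abs_le]; constructor <;> linarith
      have := mul_le_mul h3 (h1.trans (mul_le_mul_of_nonneg_left h2 zero_le_two))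
        (abs_nonneg _) (by norm_num)
      linarith
    · rw [abs_mul]
      exact mul_le_mul_of_nonneg_right (hb _) (abs_nonneg _)
  have hmeas : Continuous fun x : EuclideanSpace ℝ (Fin N) =>
      (1 + deriv θ (x i)) * signedDist E (stretch i θ x) :=
    (continuous_const.add ((hθ.continuous_deriv le_rfl).comp
      (EuclideanSpace.proj (𝕜 := ℝ) i).continuous)).mul
      ((continuous_signedDist E).comp (contDiff_stretch i hθ).continuous)
  have hdiff : IntegrableOn (fun x =>
      (1 + deriv θ (x i)) * signedDist E (stretch i θ x) - signedDist E x) F :=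
    (hcf.add (hi.abs.const_mul κ)).mono'
      (hmeas.sub (continuous_signedDist E)).aestronglyMeasurable (.of_forall hbd)
  have hi' : IntegrableOn (fun x => (1 + deriv θ (x i)) * signedDist E (stretch i θ x)) F := by
    have := hdiff.add hi
    refine this.congr (.of_forall fun x => ?_)
    simp
  obtain ⟨t1, t2⟩ := toReal_dissipation hE0 hE1 hE
    (measurableSet_image_stretch i hθd hb' hF).nullMeasurableSet hdE
    ((integrableOn_image_stretch i hθd hb' hF).2 hi')
  obtain ⟨-, t3⟩ := toReal_dissipation hE0 hE1 hE hF.nullMeasurableSet hdE hi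
  refine ⟨t1, ?_⟩
  have h4 : (∫ x in F, (1 + deriv θ (x i)) * signedDist E (stretch i θ x)) -
      ∫ x in F, signedDist E x ≤ 3 * C * volume.real F + κ * ∫ x in F, |signedDist E x| := by
    rw [← integral_sub hi' hi, ← integral_const_mul]
    calc _ ≤ ∫ x in F, (3 * C + κ * |signedDist E x|) :=
          integral_mono hdiff (hcf.add (hi.abs.const_mul κ)) fun x => (le_abs_self _).trans (hbd x)
      _ = _ := by
          rw [integral_add hcf (hi.abs.const_mul κ), setIntegral_const, smul_eq_mul]
          ring
  rw [setIntegral_image_stretch i hθd hb' hF] at t2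
  have h5 := mul_le_mul_of_nonneg_left hle hκ0
  linarith

/-- For sets of volume `m`, the constrained and the penalized energies differ by a constant. -/
theorem constrainedEnergy_add_depthIntegral {E F : Set (EuclideanSpace ℝ (Fin N))}
    (hE0 : E.Nonempty) (hE1 : E ≠ univ) (hE : NullMeasurableSet E volume)
    (hF : NullMeasurableSet F volume) (hdE : depthIntegral E ≠ ∞) {m τ : ℝ} (hτ : 0 < τ)
    (Λ : ℝ) (hFm : volume F = ENNReal.ofReal m) :
    constrainedEnergy τ E F + ((1 / τ * (depthIntegral E).toReal : ℝ) : EReal) =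
      (penalizedEnergy m τ Λ E F : EReal) := by
  have e := depthIntegral_eq_add E hF
  have hB := ne_top_of_le_ne_top hdE (e ▸ le_self_add)
  have hC := ne_top_of_le_ne_top hdE (e ▸ le_add_self)
  unfold constrainedEnergy signedDistIntegral penalizedEnergy volumeDefect
  rw [hFm, tsub_self, add_zero, mul_zero, add_zero, dissipation_eq_add hE hF, e,
    setLIntegral_signedDist hE0 hE1 hE hF, setLIntegral_neg_signedDist hE0 hE1 hE hF,
    ENNReal.toReal_add hB hC]
  generalize (∫⁻ x in F \ E, ENNReal.ofReal (Metric.infDist x (frontier E))) = A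
  generalize (∫⁻ x in F ∩ E, ENNReal.ofReal (Metric.infDist x (frontier E))) = B at *
  generalize (∫⁻ x in E \ F, ENNReal.ofReal (Metric.infDist x (frontier E))) = C at *
  have h1 : (0 : ℝ) < 1 / τ := by positivity
  lift B to NNReal using hB
  lift C to NNReal using hC
  generalize perimeter F = P
  have hc : ∀ y : NNReal, ((y : ℝ≥0∞) : EReal) = ((y : ℝ) : EReal) := fun _ => rfl
  induction A with
  | top =>
    rw [top_add, ENNReal.mul_top (by simpa using hτ), add_top, EReal.coe_ennreal_top,
      EReal.top_sub (by simp), EReal.coe_mul_top_of_pos h1, EReal.add_top_of_ne_bot (by simp),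
      EReal.top_add_of_ne_bot (EReal.coe_ne_bot _)]
  | coe a =>
    induction P with
    | top =>
      rw [top_add, EReal.coe_ennreal_top, EReal.top_add_of_ne_bot,
        EReal.top_add_of_ne_bot (EReal.coe_ne_bot _)]
      rw [hc, hc, ← EReal.coe_sub, ← EReal.coe_mul]
      exact EReal.coe_ne_bot _
    | coe p =>
      have : ((p : ℝ≥0∞) + ENNReal.ofReal (1 / τ) * ((a : ℝ≥0∞) + C)) =
          ((p + Real.toNNReal (1 / τ) * (a + C) : NNReal) : ℝ≥0∞) := by
        push_cast
        rfl
      rw [this]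
      simp only [hc, ENNReal.coe_toReal]
      rw [← EReal.coe_sub, ← EReal.coe_mul, ← EReal.coe_add, ← EReal.coe_add, EReal.coe_eq_coe_iff]
      push_cast
      rw [Real.coe_toNNReal _ h1.le]
      ring

theorem exists_infDist_frontier_le (i : Fin N) (m : ℝ) : ∃ ρ : ℝ, 0 < ρ ∧
    ∀ E : Set (EuclideanSpace ℝ (Fin N)), volume E = ENNReal.ofReal m →
      E ≠ univ ∧ ∀ x ∈ E, Metric.infDist x (frontier E) ≤ ρ := by
  have : Nonempty (Fin N) := ⟨i⟩
  have hu : volume (univ : Set (EuclideanSpace ℝ (Fin N))) = ∞ :=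
    measure_univ_of_isAddLeftInvariant _
  have ht : Tendsto (fun n : ℕ => volume (Metric.ball (0 : EuclideanSpace ℝ (Fin N)) n)) atTop
      (𝓝 ∞) := by
    rw [← hu, ← Metric.iUnion_ball_nat (0 : EuclideanSpace ℝ (Fin N))]
    refine tendsto_measure_iUnion_atTop fun a b hab => ?_
    exact Metric.ball_subset_ball (by exact_mod_cast hab)
  obtain ⟨n, hn, hn1⟩ := ((ht.eventually_const_lt (ENNReal.ofReal_lt_top (r := m))).and
    (eventually_ge_atTop 1)).exists
  refine ⟨n, by exact_mod_cast hn1, fun E hEm => ?_⟩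
  have hE : E ≠ univ := fun h => by
    rw [h, hu] at hEm
    exact ENNReal.ofReal_ne_top hEm.symm
  refine ⟨hE, fun x hx => ?_⟩
  rw [← infDist_compl_eq_infDist_frontier hE hx]
  by_contra! hlt
  have h1 : Metric.ball x n ⊆ E :=
    (Metric.ball_subset_ball hlt.le).trans Metric.ball_infDist_compl_subset
  have h2 := measure_mono (μ := volume) h1
  rw [hEm, Measure.addHaar_ball_center] at h2
  exact absurd h2 (not_le.2 hn)

theorem exists_subseq_tendsto_measureReal_inter {α : Type*} [MeasurableSpace α] {μ : Measure α}
    [IsSeparable μ] {F : ℕ → Set α} (hF : ∀ k, MeasurableSet (F k)) {V : ℝ}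
    (hfin : ∀ k, μ (F k) ≠ ∞) (hV : ∀ k, μ.real (F k) ≤ V) :
    ∃ φ : ℕ → ℕ, StrictMono φ ∧ ∀ B, MeasurableSet B → μ B ≠ ∞ →
      ∃ a, Tendsto (fun k => μ.real (F (φ k) ∩ B)) atTop (𝓝 a) := by
  have : Fact ((2 : ℝ≥0∞) ≠ ∞) := ⟨ENNReal.ofNat_ne_top⟩
  set u : ℕ → Lp ℝ 2 μ := fun k => indicatorConstLp 2 (hF k) (hfin k) 1 with hu
  have hun : ∀ k, ‖u k‖ ≤ Real.sqrt V := by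
    intro k
    rw [hu]
    simp only
    rw [norm_indicatorConstLp two_ne_zero ENNReal.ofNat_ne_top]
    simp only [norm_one, one_mul, ENNReal.toReal_ofNat, ← Real.sqrt_eq_rpow]
    exact Real.sqrt_le_sqrt (hV k)
  obtain ⟨w, -, φ, hφ, hw⟩ := WeakDual.isSeqCompact_closedBall ℝ (Lp ℝ 2 μ) 0 (Real.sqrt V)
    (x := fun k => StrongDual.toWeakDual (innerSL ℝ (u k))) (fun k => by
      simpa using hun k)
  refine ⟨φ, hφ, fun B hB hBf => ⟨w (indicatorConstLp 2 hB hBf 1), ?_⟩⟩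
  have h1 := ((WeakDual.eval_continuous (indicatorConstLp 2 hB hBf (1 : ℝ))).tendsto w).comp hw
  refine h1.congr fun k => ?_
  exact L2.real_inner_indicatorConstLp_one_indicatorConstLp_one (hF _) hB (hfin _) hBf

theorem exists_subseq_limit_of_cauchy {α : Type*} [MeasurableSpace α] {μ : Measure α}
    {F : ℕ → Set α} (hF : ∀ k, MeasurableSet (F k))
    (hc : ∀ ε : ℝ, 0 < ε → ∃ n, ∀ k ≥ n, ∀ l ≥ n, μ (F k ∆ F l) ≤ ENNReal.ofReal ε) :
    ∃ φ : ℕ → ℕ, StrictMono φ ∧ ∃ G, MeasurableSet G ∧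
      (∀ᵐ x ∂μ, ∀ᶠ k in atTop, (x ∈ F (φ k) ↔ x ∈ G)) ∧
      Tendsto (fun k => μ (F (φ k) ∆ G)) atTop (𝓝 0) := by
  obtain ⟨φ, hφ, hφc⟩ := extraction_forall_of_eventually
    (P := fun n k => ∀ l ≥ k, μ (F k ∆ F l) ≤ ENNReal.ofReal ((1 / 2) ^ n)) (fun n => by
      obtain ⟨j, hj⟩ := hc ((1 / 2) ^ n) (by positivity)
      filter_upwards [eventually_ge_atTop j] with k hk l hl
      exact hj k hk l (hk.trans hl))
  set D : ℕ → Set α := fun k => F (φ k) ∆ F (φ (k + 1)) with hD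
  have hDs : ∑' k, μ (D k) ≠ ∞ := by
    refine ne_top_of_le_ne_top ?_
      (ENNReal.tsum_le_tsum fun k => hφc k _ (hφ k.lt_succ_self).le)
    rw [← ENNReal.ofReal_tsum_of_nonneg (fun n => by positivity)
      (summable_geometric_of_lt_one (by norm_num) (by norm_num))]
    exact ENNReal.ofReal_ne_top
  set G : Set α := ⋃ n, ⋂ k, F (φ (k + n)) with hG
  have hconst : ∀ x n, (∀ j ≥ n, x ∉ D j) → ∀ k ≥ n, (x ∈ F (φ k) ↔ x ∈ F (φ n)) := by
    intro x n hx k hk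
    induction k, hk using Nat.le_induction with
    | base => rfl
    | succ k hk ih =>
      rw [← ih]
      have := hx k hk
      rw [hD, mem_symmDiff] at this
      tauto
  have hmem : ∀ x n, (∀ j ≥ n, x ∉ D j) → ∀ k ≥ n, (x ∈ F (φ k) ↔ x ∈ G) := by
    intro x n hx k hk
    rw [hG, mem_iUnion]
    simp only [mem_iInter]
    constructor
    · intro h
      exact ⟨n, fun j => (hconst x n hx (j + n) (Nat.le_add_left _ _)).2
        ((hconst x n hx k hk).1 h)⟩
    · rintro ⟨p, hp⟩
      have h1 := (hconst x n hx (n + p) (Nat.le_add_right _ _)).1 (hp n)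
      exact (hconst x n hx k hk).2 h1
  refine ⟨φ, hφ, G, .iUnion fun n => .iInter fun k => hF _, ?_, ?_⟩
  · filter_upwards [ae_eventually_notMem hDs] with x hx
    obtain ⟨n, hn⟩ := eventually_atTop.1 hx
    exact eventually_atTop.2 ⟨n, hmem x n hn⟩
  · refine tendsto_of_tendsto_of_tendsto_of_le_of_le tendsto_const_nhds
      (ENNReal.tendsto_sum_nat_add _ hDs) (fun _ => zero_le) fun k => ?_
    refine (measure_mono fun x hx => ?_).trans (measure_iUnion_le fun j => D (j + k))
    by_contra h
    simp only [mem_iUnion, not_exists] at h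
    have := hmem x k (fun j hj => by
      have := h (j - k)
      rwa [Nat.sub_add_cancel hj] at this) k le_rfl
    rw [mem_symmDiff] at hx
    tauto

theorem measurable_volume_inter_ball {G : Set (EuclideanSpace ℝ (Fin N))}
    (hG : MeasurableSet G) (r : ℝ) : Measurable fun x => volume (G ∩ Metric.ball x r) := by
  have hS : MeasurableSet {p : EuclideanSpace ℝ (Fin N) × EuclideanSpace ℝ (Fin N) |
      p.2 ∈ G ∧ dist p.2 p.1 < r} :=
    (hG.preimage measurable_snd).inter
      (measurableSet_lt (measurable_snd.dist measurable_fst) measurable_const)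
  exact measurable_measure_prodMk_left hS

theorem setLIntegral_compl_volume_inter_ball (G : Set (EuclideanSpace ℝ (Fin N))) (r : ℝ) :
    ∫⁻ x in Gᶜ, volume (G ∩ Metric.ball x r) = ∫⁻ x in G, volume (Metric.ball x r \ G) := by
  set S : Set (EuclideanSpace ℝ (Fin N) × EuclideanSpace ℝ (Fin N)) := {p | dist p.1 p.2 < r}
  have hS : MeasurableSet S := measurableSet_lt (measurable_fst.dist measurable_snd)
    measurable_const
  have e1 : ∀ x, volume (G ∩ Metric.ball x r) =
      ∫⁻ y in G, S.indicator (fun _ => (1 : ℝ≥0∞)) (x, y) := fun x => by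
    have : (fun z => S.indicator (fun _ => (1 : ℝ≥0∞)) (x, z)) =
        (Prod.mk x ⁻¹' S).indicator (fun _ => 1) := rfl
    rw [this, lintegral_indicator (measurable_prodMk_left hS), setLIntegral_one,
      Measure.restrict_apply (measurable_prodMk_left hS)]
    congr 1
    ext y
    simp [S, and_comm, dist_comm]
  have e2 : ∀ y, volume (Metric.ball y r \ G) =
      ∫⁻ x in Gᶜ, S.indicator (fun _ => (1 : ℝ≥0∞)) (x, y) := fun y => by
    have : (fun x => S.indicator (fun _ => (1 : ℝ≥0∞)) (x, y)) =
        ((fun x => (x, y)) ⁻¹' S).indicator (fun _ => 1) := rfl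
    rw [this, lintegral_indicator (measurable_prodMk_right hS), setLIntegral_one,
      Measure.restrict_apply (measurable_prodMk_right hS)]
    rfl
  simp_rw [e1, e2]
  exact lintegral_lintegral_swap (measurable_const.indicator hS).aemeasurable

theorem volume_diff_inter_mul_le {F G A : Set (EuclideanSpace ℝ (Fin N))}
    (hF : MeasurableSet F) (hG : MeasurableSet G) (r : ℝ) :
    volume ((F \ G) ∩ A) * volume (Metric.ball (0 : EuclideanSpace ℝ (Fin N)) r) ≤
      (∫⁻ x in F, volume (Metric.ball x r \ F)) + (∫⁻ x in G, volume (Metric.ball x r \ G)) +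
      ∫⁻ x in A, ‖volume.real (F ∩ Metric.ball x r) - volume.real (G ∩ Metric.ball x r)‖ₑ := by
  have hmF := measurable_volume_inter_ball hF r
  have hmG := measurable_volume_inter_ball hG r
  have hfin : ∀ (H : Set (EuclideanSpace ℝ (Fin N))) x, volume (H ∩ Metric.ball x r) ≠ ∞ :=
    fun H x => measure_ne_top_of_subset inter_subset_right measure_ball_lt_top.ne
  have hpt : ∀ x : EuclideanSpace ℝ (Fin N),
      volume (Metric.ball (0 : EuclideanSpace ℝ (Fin N)) r) ≤
      ‖volume.real (F ∩ Metric.ball x r) - volume.real (G ∩ Metric.ball x r)‖ₑ +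
      volume (G ∩ Metric.ball x r) + volume (Metric.ball x r \ F) := by
    intro x
    rw [← Measure.addHaar_ball_center volume x r,
      ← measure_inter_add_sdiff (Metric.ball x r) hF, inter_comm]
    gcongr
    rw [← ofReal_measureReal (hfin F x), ← ofReal_measureReal (hfin G x)]
    have : volume.real (F ∩ Metric.ball x r) =
      (volume.real (F ∩ Metric.ball x r) - volume.real (G ∩ Metric.ball x r)) +
        volume.real (G ∩ Metric.ball x r) := by ring
    conv_lhs => rw [this]
    exact ENNReal.ofReal_add_le.trans (add_le_add (Real.ofReal_le_enorm _) le_rfl)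
  rw [mul_comm, ← setLIntegral_const, ← setLIntegral_compl_volume_inter_ball G]
  refine (lintegral_mono hpt).trans ?_
  have hmd : Measurable fun x : EuclideanSpace ℝ (Fin N) =>
      ‖volume.real (F ∩ Metric.ball x r) - volume.real (G ∩ Metric.ball x r)‖ₑ :=
    (hmF.ennreal_toReal.sub hmG.ennreal_toReal).enorm
  have hmdG : Measurable fun x : EuclideanSpace ℝ (Fin N) =>
      ‖volume.real (F ∩ Metric.ball x r) - volume.real (G ∩ Metric.ball x r)‖ₑ +
      volume (G ∩ Metric.ball x r) := hmd.add hmG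
  rw [lintegral_add_left hmdG, lintegral_add_left hmd,
    add_comm, ← add_assoc, add_right_comm]
  refine add_le_add (add_le_add ?_ ?_) ?_
  · exact lintegral_mono_set fun x hx => hx.1.1
  · exact lintegral_mono_set fun x hx => hx.1.2
  · exact lintegral_mono_set fun x hx => hx.2

theorem exists_forall_setLIntegral_sub_le {α : Type*} [MeasurableSpace α] {μ : Measure α}
    {A : Set α} (hA : μ A ≠ ∞) {f : ℕ → α → ℝ} (hf : ∀ k, Measurable (f k)) {b : ℝ}
    (hb : ∀ k x, |f k x| ≤ b) (hlim : ∀ x, ∃ a, Tendsto (fun k => f k x) atTop (𝓝 a))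
    {ε : ℝ≥0∞} (hε : ε ≠ 0) :
    ∃ n, ∀ k ≥ n, ∀ l ≥ n, ∫⁻ x in A, ‖f k x - f l x‖ₑ ∂μ ≤ ε := by
  choose a ha using hlim
  have ham : Measurable a := measurable_of_tendsto_metrizable hf (tendsto_pi_nhds.2 ha)
  have hab : ∀ x, |a x| ≤ b := fun x => le_of_tendsto (ha x).abs (.of_forall fun k => hb k x)
  have h0 : Tendsto (fun k => ∫⁻ x in A, ‖f k x - a x‖ₑ ∂μ) atTop (𝓝 0) := by
    have := tendsto_lintegral_of_dominated_convergence (μ := μ.restrict A)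
      (F := fun k x => ‖f k x - a x‖ₑ) (f := fun _ => 0) (fun _ => ENNReal.ofReal (2 * b))
      (fun k => ((hf k).sub ham).enorm) (fun k => .of_forall fun x => ?_) ?_
      (.of_forall fun x => ?_)
    · simpa using this
    · simp only
      rw [← ofReal_norm, Real.norm_eq_abs]
      refine ENNReal.ofReal_le_ofReal ((abs_sub _ _).trans ?_)
      linarith [hb k x, hab x]
    · rw [setLIntegral_const]
      exact ENNReal.mul_ne_top ENNReal.ofReal_ne_top hA
    · have := ((ha x).sub_const (a x)).enorm
      simpa using this
  obtain ⟨n, hn⟩ := eventually_atTop.1 (h0.eventually_le_const (ENNReal.half_pos hε))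
  refine ⟨n, fun k hk l hl => ?_⟩
  rw [← ENNReal.add_halves ε]
  refine le_trans ?_ (add_le_add (hn k hk) (hn l hl))
  have hm : Measurable fun x => ‖f k x - a x‖ₑ := ((hf k).sub ham).enorm
  rw [← lintegral_add_left hm]
  refine lintegral_mono fun x => ?_
  rw [← edist_eq_enorm_sub, ← edist_eq_enorm_sub, ← edist_eq_enorm_sub]
  exact edist_triangle_right _ _ _

/-- Sets of uniformly bounded volume and perimeter that do not lose mass at infinity are
precompact in `L¹`. -/
theorem exists_subseq_limit_of_perimeter_le {F : ℕ → Set (EuclideanSpace ℝ (Fin N))}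
    (hF : ∀ k, MeasurableSet (F k)) {V C : ℝ} (hfin : ∀ k, volume (F k) ≠ ∞)
    (hV : ∀ k, volume.real (F k) ≤ V) (hP : ∀ k, perimeter (F k) ≠ ∞)
    (hC : ∀ k, (perimeter (F k)).toReal ≤ C)
    (htight : ∀ ε : ℝ, 0 < ε → ∃ R : ℝ, ∀ k,
      volume (F k \ Metric.ball 0 R) ≤ ENNReal.ofReal ε) :
    ∃ φ : ℕ → ℕ, StrictMono φ ∧ ∃ G, MeasurableSet G ∧
      (∀ᵐ x, ∀ᶠ k in atTop, (x ∈ F (φ k) ↔ x ∈ G)) ∧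
      Tendsto (fun k => volume (F (φ k) ∆ G)) atTop (𝓝 0) := by
  obtain ⟨φ, hφ, hlim⟩ := exists_subseq_tendsto_measureReal_inter hF hfin hV
  have hC0 : 0 ≤ C := ENNReal.toReal_nonneg.trans (hC 0)
  have hcauchy : ∀ ε : ℝ, 0 < ε → ∃ n, ∀ k ≥ n, ∀ l ≥ n,
      volume (F (φ k) ∆ F (φ l)) ≤ ENNReal.ofReal ε := by
    intro ε hε
    obtain ⟨R, hR⟩ := htight (ε / 4) (by positivity)
    set r : ℝ := ε / (16 * (C + 1)) with hr
    have hr0 : 0 < r := by positivity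
    have hrC : r * C ≤ ε / 16 := by
      rw [hr, div_mul_eq_mul_div, div_le_div_iff₀ (by positivity) (by norm_num)]
      nlinarith
    set b := volume (Metric.ball (0 : EuclideanSpace ℝ (Fin N)) r) with hb
    have hb0 : b ≠ 0 := (Metric.measure_ball_pos _ _ hr0).ne'
    have hbt : b ≠ ∞ := measure_ball_lt_top.ne
    obtain ⟨n, hn⟩ := exists_forall_setLIntegral_sub_le (μ := volume)
      (A := Metric.ball (0 : EuclideanSpace ℝ (Fin N)) R) measure_ball_lt_top.ne
      (f := fun k x => volume.real (F (φ k) ∩ Metric.ball x r)) (b := b.toReal)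
      (fun k => (measurable_volume_inter_ball (hF _) r).ennreal_toReal) (fun k x => by
        rw [abs_of_nonneg measureReal_nonneg]
        refine ENNReal.toReal_mono hbt ((measure_mono inter_subset_right).trans ?_)
        rw [Measure.addHaar_ball_center])
      (fun x => hlim _ Metric.isOpen_ball.measurableSet measure_ball_lt_top.ne)
      (ε := b * ENNReal.ofReal (ε / 8))
      (mul_ne_zero hb0 (ENNReal.ofReal_pos.2 (by positivity)).ne')
    have hT : ∀ k, ∫⁻ x in F k, volume (Metric.ball x r \ F k) ≤ b * ENNReal.ofReal (ε / 16) :=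
      fun k => (setLIntegral_volume_ball_diff_le (hF k) (hfin k) (hP k) r).trans <| by
        gcongr
        exact (mul_le_mul_of_nonneg_left (hC k) hr0.le).trans hrC
    have hone : ∀ k ≥ n, ∀ l ≥ n, volume (F (φ k) \ F (φ l)) ≤ ENNReal.ofReal (ε / 2) := by
      intro k hk l hl
      have h1 := (volume_diff_inter_mul_le (A := Metric.ball 0 R) (hF (φ k)) (hF (φ l)) r).trans
        (add_le_add (add_le_add (hT _) (hT _)) (hn k hk l hl))
      rw [← mul_add, ← mul_add, mul_comm, ← hb, ENNReal.mul_le_mul_iff_right hb0 hbt,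
        ← ENNReal.ofReal_add (by positivity) (by positivity),
        ← ENNReal.ofReal_add (by positivity) (by positivity)] at h1
      rw [← measure_inter_add_sdiff _ (Metric.isOpen_ball (x := (0 : EuclideanSpace ℝ (Fin N)))
        (ε := R)).measurableSet]
      refine (add_le_add h1 ((measure_mono (sdiff_subset_sdiff_left sdiff_subset)).trans
        (hR (φ k)))).trans ?_
      rw [← ENNReal.ofReal_add (by positivity) (by positivity)]
      exact ENNReal.ofReal_le_ofReal (by linarith)
    refine ⟨n, fun k hk l hl => ?_⟩
    rw [Set.symmDiff_def]
    refine (measure_union_le _ _).trans ((add_le_add (hone k hk l hl) (hone l hl k hk)).trans ?_)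
    rw [← ENNReal.ofReal_add (by positivity) (by positivity), add_halves]
  obtain ⟨ψ, hψ, G, hG, h1, h2⟩ := exists_subseq_limit_of_cauchy (fun k => hF (φ k)) hcauchy
  exact ⟨φ ∘ ψ, hφ.comp hψ, G, hG, h1, h2⟩

theorem volumeDefect_eq_ofReal {m : ℝ} (hm : 0 ≤ m) {F : Set (EuclideanSpace ℝ (Fin N))}
    (hF : volume F ≠ ∞) : volumeDefect m F = ENNReal.ofReal |volume.real F - m| := by
  unfold volumeDefect
  rw [← ofReal_measureReal hF, ← ENNReal.ofReal_sub _ hm,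
    ← ENNReal.ofReal_sub _ measureReal_nonneg]
  rcases le_total m (volume.real F) with h | h
  · rw [ENNReal.ofReal_of_nonpos (sub_nonpos.2 h), add_zero, abs_of_nonneg (sub_nonneg.2 h)]
  · rw [ENNReal.ofReal_of_nonpos (sub_nonpos.2 h), zero_add, abs_of_nonpos (sub_nonpos.2 h),
      neg_sub]

theorem penalizedEnergy_eq_ofReal {m τ Λ : ℝ} (hm : 0 ≤ m) (hτ : 0 < τ) (hΛ : 0 ≤ Λ)
    {E F : Set (EuclideanSpace ℝ (Fin N))} (hF : volume F ≠ ∞) (hP : perimeter F ≠ ∞)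
    (hD : dissipation F E ≠ ∞) :
    penalizedEnergy m τ Λ E F = ENNReal.ofReal ((perimeter F).toReal +
      1 / τ * (dissipation F E).toReal + Λ * |volume.real F - m|) := by
  rw [penalizedEnergy, volumeDefect_eq_ofReal hm hF, ENNReal.ofReal_add (by positivity)
    (by positivity), ENNReal.ofReal_add (by positivity) (by positivity),
    ENNReal.ofReal_mul (by positivity), ENNReal.ofReal_mul (by positivity),
    ENNReal.ofReal_toReal hP, ENNReal.ofReal_toReal hD]

theorem penalizedEnergy_self {m : ℝ} (τ Λ : ℝ) {E : Set (EuclideanSpace ℝ (Fin N))}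
    (hE : volume E = ENNReal.ofReal m) : penalizedEnergy m τ Λ E E = perimeter E := by
  simp [penalizedEnergy, dissipation, volumeDefect, hE]

theorem bounds_of_penalizedEnergy_le {m τ Λ A : ℝ} (hm : 0 ≤ m) (hτ : 0 < τ) (hΛ : 0 < Λ)
    (hA : 0 ≤ A) {E F : Set (EuclideanSpace ℝ (Fin N))}
    (h : penalizedEnergy m τ Λ E F ≤ ENNReal.ofReal A) :
    (perimeter F ≠ ∞ ∧ (perimeter F).toReal ≤ A) ∧
      dissipation F E ≤ ENNReal.ofReal (τ * A) ∧
      volume F ≠ ∞ ∧ |volume.real F - m| ≤ A / Λ := by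
  have h1 : perimeter F ≤ ENNReal.ofReal A := (le_self_add.trans le_self_add).trans h
  have h2 : ENNReal.ofReal (1 / τ) * dissipation F E ≤ ENNReal.ofReal A :=
    (le_add_self.trans le_self_add).trans h
  have h3 : ENNReal.ofReal Λ * volumeDefect m F ≤ ENNReal.ofReal A := le_add_self.trans h
  refine ⟨⟨ne_top_of_le_ne_top ENNReal.ofReal_ne_top h1, ENNReal.toReal_le_of_le_ofReal hA h1⟩,
    ?_, ?_⟩
  · have := mul_le_mul_right h2 (ENNReal.ofReal τ)
    rwa [← mul_assoc, ← ENNReal.ofReal_mul hτ.le, mul_one_div_cancel hτ.ne', ENNReal.ofReal_one,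
      one_mul, ← ENNReal.ofReal_mul hτ.le] at this
  · have hv : volume F ≠ ∞ := by
      intro hv
      have : volumeDefect m F = ∞ := by simp [volumeDefect, hv]
      rw [this, ENNReal.mul_top (ENNReal.ofReal_pos.2 hΛ).ne'] at h3
      exact ENNReal.ofReal_ne_top (top_le_iff.1 h3)
    refine ⟨hv, ?_⟩
    rw [volumeDefect_eq_ofReal hm hv, ← ENNReal.ofReal_mul hΛ.le,
      ENNReal.ofReal_le_ofReal_iff hA] at h3
    rwa [le_div_iff₀' hΛ]

theorem volume_diff_ball_mul_le {E : Set (EuclideanSpace ℝ (Fin N))} (hE0 : E.Nonempty)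
    (hE1 : E ≠ univ) (F : Set (EuclideanSpace ℝ (Fin N))) {R L : ℝ} (hL : 0 < L)
    (hE : E ⊆ Metric.closedBall 0 R) :
    ENNReal.ofReal L * volume (F \ Metric.ball 0 (R + L)) ≤ dissipation F E := by
  have hfr : (frontier E).Nonempty := nonempty_frontier_iff.2 ⟨hE0, hE1⟩
  have hfE : frontier E ⊆ Metric.closedBall 0 R :=
    frontier_subset_closure.trans (closure_minimal hE Metric.isClosed_closedBall)
  have hfar : ∀ x ∉ Metric.ball (0 : EuclideanSpace ℝ (Fin N)) (R + L),
      L ≤ Metric.infDist x (frontier E) := by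
    intro x hx
    refine (Metric.le_infDist hfr).2 fun y hy => ?_
    have h1 := Metric.mem_closedBall.1 (hfE hy)
    have h2 := dist_triangle x y 0
    rw [Metric.mem_ball, not_lt] at hx
    linarith
  have hsub : F \ Metric.ball 0 (R + L) ⊆
      E ∆ F ∩ {x | ENNReal.ofReal L ≤ ENNReal.ofReal (Metric.infDist x (frontier E))} := by
    intro x hx
    refine ⟨Or.inr ⟨hx.1, fun h => hx.2 ?_⟩, ENNReal.ofReal_le_ofReal (hfar x hx.2)⟩
    exact Metric.ball_subset_ball le_rfl
      (Metric.mem_ball.2 ((Metric.mem_closedBall.1 (hE h)).trans_lt (by linarith)))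
  have hm : Measurable fun x => ENNReal.ofReal (Metric.infDist x (frontier E)) :=
    (Metric.continuous_infDist_pt _).measurable.ennreal_ofReal
  refine le_trans ?_ (mul_meas_ge_le_lintegral (μ := volume.restrict (E ∆ F)) hm
    (ENNReal.ofReal L))
  rw [Measure.restrict_apply (measurableSet_le measurable_const hm), inter_comm]
  gcongr

theorem tendsto_setIntegral_of_eventually_mem_iff {α : Type*} [MeasurableSpace α] {μ : Measure α}
    {F : ℕ → Set α} {G : Set α} (hF : ∀ k, MeasurableSet (F k)) (hG : MeasurableSet G)
    (h : ∀ᵐ x ∂μ, ∀ᶠ k in atTop, (x ∈ F k ↔ x ∈ G)) {f : α → ℝ} (hf : Integrable f μ) :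
    Tendsto (fun k => ∫ x in F k, f x ∂μ) atTop (𝓝 (∫ x in G, f x ∂μ)) := by
  simp_rw [← integral_indicator hG, ← integral_indicator (hF _)]
  refine tendsto_integral_of_dominated_convergence (fun x => ‖f x‖)
    (fun k => hf.1.indicator (hF k)) hf.norm
    (fun k => .of_forall fun x => norm_indicator_le_norm_self _ _) ?_
  filter_upwards [h] with x hx
  refine tendsto_const_nhds.congr' ?_
  filter_upwards [hx] with k hk
  by_cases hxG : x ∈ G
  · rw [indicator_of_mem hxG, indicator_of_mem (hk.2 hxG)]
  · rw [indicator_of_notMem hxG, indicator_of_notMem fun h => hxG (hk.1 h)]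

theorem dissipation_le_liminf {F : ℕ → Set (EuclideanSpace ℝ (Fin N))}
    {E G : Set (EuclideanSpace ℝ (Fin N))} (hE : NullMeasurableSet E volume)
    (hF : ∀ k, MeasurableSet (F k)) (hG : MeasurableSet G)
    (h : ∀ᵐ x, ∀ᶠ k in atTop, (x ∈ F k ↔ x ∈ G)) :
    dissipation G E ≤ liminf (fun k => dissipation (F k) E) atTop := by
  have hs : ∀ {H : Set (EuclideanSpace ℝ (Fin N))}, MeasurableSet H →
      NullMeasurableSet (E ∆ H) volume := fun hH => by
    rw [Set.symmDiff_def]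
    exact (hE.diff hH.nullMeasurableSet).union (hH.nullMeasurableSet.diff hE)
  have hm : Measurable fun x => ENNReal.ofReal (Metric.infDist x (frontier E)) :=
    (Metric.continuous_infDist_pt _).measurable.ennreal_ofReal
  unfold dissipation
  simp_rw [← lintegral_indicator₀ (hs hG), ← lintegral_indicator₀ (hs (hF _))]
  refine le_trans (lintegral_mono_ae ?_)
    (lintegral_liminf_le' fun k => hm.aemeasurable.indicator₀ (hs (hF k)))
  filter_upwards [h] with x hx
  refine (Tendsto.liminf_eq (tendsto_const_nhds.congr' ?_)).ge
  filter_upwards [hx] with k hk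
  have : x ∈ E ∆ F k ↔ x ∈ E ∆ G := by simp [mem_symmDiff, hk]
  by_cases hxG : x ∈ E ∆ G
  · rw [indicator_of_mem hxG, indicator_of_mem (this.2 hxG)]
  · rw [indicator_of_notMem hxG, indicator_of_notMem fun h => hxG (this.1 h)]

theorem tendsto_volumeDefect {F : ℕ → Set (EuclideanSpace ℝ (Fin N))}
    {G : Set (EuclideanSpace ℝ (Fin N))} (m : ℝ)
    (h : Tendsto (fun k => volume (F k ∆ G)) atTop (𝓝 0)) :
    Tendsto (fun k => volumeDefect m (F k)) atTop (𝓝 (volumeDefect m G)) := by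
  have hv : Tendsto (fun k => volume (F k)) atTop (𝓝 (volume G)) := by
    have h1 : Tendsto (fun k => volume G - volume (F k ∆ G)) atTop (𝓝 (volume G)) := by
      simpa using ENNReal.Tendsto.sub (tendsto_const_nhds (x := volume G)) h
        (Or.inr ENNReal.zero_ne_top)
    have h2 : Tendsto (fun k => volume G + volume (F k ∆ G)) atTop (𝓝 (volume G)) := by
      simpa using (tendsto_const_nhds (x := volume G)).add h
    refine tendsto_of_tendsto_of_tendsto_of_le_of_le h1 h2 (fun k => ?_) fun k => ?_
    · refine tsub_le_iff_right.2 ((measure_mono fun x hx => ?_).trans (measure_union_le _ _))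
      by_cases hxF : x ∈ F k
      · exact Or.inl hxF
      · exact Or.inr (Or.inr ⟨hx, hxF⟩)
    · refine (measure_mono fun x hx => ?_).trans (measure_union_le _ _)
      by_cases hxG : x ∈ G
      · exact Or.inl hxG
      · exact Or.inr (Or.inl ⟨hx, hxG⟩)
  exact (ENNReal.Tendsto.sub hv tendsto_const_nhds (Or.inr ENNReal.ofReal_ne_top)).add
    (ENNReal.Tendsto.sub tendsto_const_nhds hv (Or.inl ENNReal.ofReal_ne_top))

theorem penalizedEnergy_le_of_tendsto {F : ℕ → Set (EuclideanSpace ℝ (Fin N))}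
    {E G : Set (EuclideanSpace ℝ (Fin N))} (hE : NullMeasurableSet E volume)
    (hF : ∀ k, MeasurableSet (F k)) (hG : MeasurableSet G)
    (h : ∀ᵐ x, ∀ᶠ k in atTop, (x ∈ F k ↔ x ∈ G))
    (h' : Tendsto (fun k => volume (F k ∆ G)) atTop (𝓝 0))
    {m τ Λ : ℝ} (hτ : 0 < τ) {e : ℕ → ℝ≥0∞} {I : ℝ≥0∞} (hI : I ≠ ∞)
    (he : Tendsto e atTop (𝓝 I)) (het : ∀ k, e k ≠ ∞) (hle : ∀ k, penalizedEnergy m τ Λ E (F k) ≤ e k) :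
    penalizedEnergy m τ Λ E G ≤ I := by
  have hc0 : ENNReal.ofReal (1 / τ) ≠ 0 := (ENNReal.ofReal_pos.2 (by positivity)).ne'
  have hct : ENNReal.ofReal (1 / τ) ≠ ∞ := ENNReal.ofReal_ne_top
  have key : ∀ X : EuclideanSpace ℝ (Fin N) → EuclideanSpace ℝ (Fin N), ContDiff ℝ 1 X →
      HasCompactSupport X → (∀ x, ‖X x‖ ≤ 1) → ENNReal.ofReal (∫ x in G, divergence X x) +
        (ENNReal.ofReal (1 / τ) * dissipation G E + ENNReal.ofReal Λ * volumeDefect m G) ≤ I := by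
    intro X hX hXc hX1
    set y : ℕ → ℝ≥0∞ := fun k => ENNReal.ofReal (∫ x in F k, divergence X x) +
      ENNReal.ofReal Λ * volumeDefect m (F k) with hy
    have hyt : Tendsto y atTop (𝓝 (ENNReal.ofReal (∫ x in G, divergence X x) +
        ENNReal.ofReal Λ * volumeDefect m G)) :=
      (ENNReal.tendsto_ofReal (tendsto_setIntegral_of_eventually_mem_iff hF hG h
        (integrable_divergence hX hXc))).add
        (ENNReal.Tendsto.const_mul (tendsto_volumeDefect m h') (Or.inr ENNReal.ofReal_ne_top))
    have hye : ∀ k, y k + ENNReal.ofReal (1 / τ) * dissipation (F k) E ≤ e k := by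
      intro k
      refine le_trans ?_ (hle k)
      rw [hy, penalizedEnergy, add_right_comm]
      gcongr
      exact le_iSup_of_le X (le_iSup_of_le hX (le_iSup_of_le hXc (le_iSup_of_le hX1 le_rfl)))
    set Y := ENNReal.ofReal (∫ x in G, divergence X x) +
        ENNReal.ofReal Λ * volumeDefect m G with hY
    have hYI : Y ≤ I := le_of_tendsto_of_tendsto' hyt he fun k => le_self_add.trans (hye k)
    have hw : Tendsto (fun k => (e k - y k) / ENNReal.ofReal (1 / τ)) atTop
        (𝓝 ((I - Y) / ENNReal.ofReal (1 / τ))) :=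
      ENNReal.Tendsto.div_const (ENNReal.Tendsto.sub he hyt (Or.inl hI)) (Or.inr hc0)
    have hD : dissipation G E ≤ (I - Y) / ENNReal.ofReal (1 / τ) := by
      refine (dissipation_le_liminf hE hF hG h).trans ?_
      rw [← hw.liminf_eq]
      refine liminf_le_liminf (.of_forall fun k => ?_)
      rw [ENNReal.le_div_iff_mul_le (Or.inl hc0) (Or.inl hct), mul_comm]
      exact ENNReal.le_sub_of_add_le_left (ne_top_of_le_ne_top (het k)
        (le_self_add.trans (hye k))) (hye k)
    rw [ENNReal.le_div_iff_mul_le (Or.inl hc0) (Or.inl hct), mul_comm] at hD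
    rw [← add_assoc, add_right_comm, ← hY]
    exact (add_le_add le_rfl hD).trans (add_tsub_cancel_of_le hYI).le
  have hrest : ENNReal.ofReal (1 / τ) * dissipation G E + ENNReal.ofReal Λ * volumeDefect m G ≠ ∞ :=
    ne_top_of_le_ne_top hI (le_add_self.trans
      (key 0 contDiff_const HasCompactSupport.zero (by simp)))
  rw [penalizedEnergy, add_assoc]
  refine (add_le_add (b := I - _) (iSup_le fun X => iSup_le fun hX => iSup_le fun hXc =>
    iSup_le fun hX1 => ENNReal.le_sub_of_add_le_right hrest (key X hX hXc hX1)) le_rfl).trans ?_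
  exact (tsub_add_cancel_of_le (le_add_self.trans
    (key 0 contDiff_const HasCompactSupport.zero (by simp)))).le

theorem exists_isPenalizedMinimizer {E : Set (EuclideanSpace ℝ (Fin N))} (hE0 : E.Nonempty)
    (hE1 : E ≠ univ) (hE : NullMeasurableSet E volume) (hEb : Bornology.IsBounded E)
    {m M τ Λ : ℝ} (hm : 0 ≤ m) (hM : 0 ≤ M) (hτ : 0 < τ) (hΛ : 0 < Λ)
    (hEm : volume E = ENNReal.ofReal m) (hEP : perimeter E ≤ ENNReal.ofReal M) :
    ∃ F, IsPenalizedMinimizer m τ Λ E F := by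
  set I : ℝ≥0∞ := ⨅ F : {F : Set (EuclideanSpace ℝ (Fin N)) // MeasurableSet F},
    penalizedEnergy m τ Λ E F with hI
  have hIle : ∀ G : Set (EuclideanSpace ℝ (Fin N)), NullMeasurableSet G volume →
      I ≤ penalizedEnergy m τ Λ E G := by
    intro G hG
    obtain ⟨H, -, hH, hHG⟩ := hG.exists_measurable_superset_ae_eq
    rw [← penalizedEnergy_congr hHG]
    exact iInf_le (fun F : {F : Set (EuclideanSpace ℝ (Fin N)) // MeasurableSet F} =>
      penalizedEnergy m τ Λ E F) ⟨H, hH⟩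
  have hIM : I ≤ ENNReal.ofReal M := by
    refine (hIle E hE).trans ?_
    rwa [penalizedEnergy_self τ Λ hEm]
  have hIt : I ≠ ∞ := ne_top_of_le_ne_top ENNReal.ofReal_ne_top hIM
  have hex : ∀ k : ℕ, ∃ F : Set (EuclideanSpace ℝ (Fin N)), MeasurableSet F ∧
      penalizedEnergy m τ Λ E F ≤ I + ENNReal.ofReal (1 / (k + 1)) := by
    intro k
    have : I < I + ENNReal.ofReal (1 / (k + 1)) :=
      ENNReal.lt_add_right hIt (ENNReal.ofReal_pos.2 (by positivity)).ne'
    obtain ⟨F, hF⟩ := iInf_lt_iff.1 this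
    exact ⟨F, F.2, hF.le⟩
  choose F hF hFe using hex
  have hb := fun k => bounds_of_penalizedEnergy_le (A := M + 1) hm hτ hΛ (by positivity)
    ((hFe k).trans (by
      rw [ENNReal.ofReal_add hM zero_le_one]
      refine add_le_add hIM (ENNReal.ofReal_le_ofReal ?_)
      rw [div_le_one (by positivity)]
      linarith [(Nat.cast_nonneg k : (0 : ℝ) ≤ k)]))
  obtain ⟨R, hR⟩ := hEb.subset_closedBall 0
  obtain ⟨φ, hφ, G, hG, h1, h2⟩ := exists_subseq_limit_of_perimeter_le hF
    (V := m + (M + 1) / Λ) (C := M + 1) (fun k => (hb k).2.2.1)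
    (fun k => by linarith [(abs_le.1 (hb k).2.2.2).2]) (fun k => (hb k).1.1)
    (fun k => (hb k).1.2) (fun ε hε => by
      have hL : 0 < τ * (M + 1) / ε := by positivity
      refine ⟨R + τ * (M + 1) / ε, fun k => ?_⟩
      have := (volume_diff_ball_mul_le hE0 hE1 (F k) hL hR).trans (hb k).2.1
      have h3 : ENNReal.ofReal (τ * (M + 1)) =
          ENNReal.ofReal (τ * (M + 1) / ε) * ENNReal.ofReal ε := by
        rw [← ENNReal.ofReal_mul hL.le, div_mul_cancel₀ _ hε.ne']
      rwa [h3, ENNReal.mul_le_mul_iff_right (ENNReal.ofReal_pos.2 hL).ne'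
        ENNReal.ofReal_ne_top] at this)
  refine ⟨G, hG.nullMeasurableSet, fun H hH => le_trans ?_ (hIle H hH)⟩
  refine penalizedEnergy_le_of_tendsto hE (fun k => hF (φ k)) hG h1 h2 hτ hIt ?_
    (fun k => ENNReal.add_ne_top.2 ⟨hIt, ENNReal.ofReal_ne_top⟩) (fun k => hFe (φ k))
  have : Tendsto (fun k : ℕ => I + ENNReal.ofReal (1 / ((k : ℝ) + 1))) atTop (𝓝 (I + 0)) := by
    refine tendsto_const_nhds.add ?_
    simpa using ENNReal.tendsto_ofReal tendsto_one_div_add_atTop_nhds_zero_nat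
  rw [add_zero] at this
  exact this.comp hφ.tendsto_atTop

theorem deriv_mul_arctan_sub (t a s : ℝ) :
    deriv (fun s => t * Real.arctan (s - a)) s = t * (1 / (1 + (s - a) ^ 2)) := by
  have h : HasDerivAt (fun s => t * Real.arctan (s - a)) (t * (1 / (1 + (s - a) ^ 2) * 1)) s :=
    (((hasDerivAt_id s).sub_const a).arctan).const_mul t
  rw [h.deriv, mul_one]

theorem abs_mul_arctan_le (t x : ℝ) : |t * Real.arctan x| ≤ 2 * |t| := by
  rw [abs_mul, mul_comm]
  refine mul_le_mul_of_nonneg_right (abs_le.2 ⟨?_, ?_⟩) (abs_nonneg _)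
  · linarith [Real.neg_pi_div_two_lt_arctan x, Real.pi_le_four]
  · linarith [Real.arctan_lt_pi_div_two x, Real.pi_le_four]

theorem one_div_one_add_sq_le_one (s : ℝ) : 1 / (1 + s ^ 2) ≤ 1 :=
  (div_le_one (by positivity)).2 (by linarith [sq_nonneg s])

theorem abs_mul_one_div_le (t s : ℝ) : |t * (1 / (1 + s ^ 2))| ≤ |t| := by
  rw [abs_mul, abs_of_nonneg (by positivity : 0 ≤ 1 / (1 + s ^ 2))]
  exact mul_le_of_le_one_right (abs_nonneg _) (one_div_one_add_sq_le_one s)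

theorem integrableOn_coord_weight {F : Set (EuclideanSpace ℝ (Fin N))} (hFv : volume F ≠ ∞)
    (i : Fin N) (a : ℝ) :
    IntegrableOn (fun x : EuclideanSpace ℝ (Fin N) => 1 / (1 + (x i - a) ^ 2)) F := by
  refine (integrableOn_const (C := (1 : ℝ)) hFv).mono' ?_ (.of_forall fun x => ?_)
  · refine Continuous.aestronglyMeasurable ?_
    have : Continuous fun x : EuclideanSpace ℝ (Fin N) => x i :=
      (EuclideanSpace.proj (𝕜 := ℝ) i).continuous
    exact continuous_const.div (by fun_prop) fun x => by positivity
  · rw [Real.norm_of_nonneg (by positivity)]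
    exact one_div_one_add_sq_le_one _

theorem volume_image_stretch {F : Set (EuclideanSpace ℝ (Fin N))} (hF : MeasurableSet F)
    (hFv : volume F ≠ ∞) (i : Fin N) (a : ℝ) {t : ℝ} (ht : |t| ≤ 1 / 2) :
    volume (stretch i (fun s => t * Real.arctan (s - a)) '' F) ≠ ∞ ∧
      volume.real (stretch i (fun s => t * Real.arctan (s - a)) '' F) =
        volume.real F + t * ∫ x in F, 1 / (1 + (x i - a) ^ 2) := by
  have hθ : Differentiable ℝ fun s : ℝ => t * Real.arctan (s - a) :=
    (Real.differentiable_arctan.comp (differentiable_id.sub_const a)).const_mul t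
  have hb : ∀ s, |deriv (fun s => t * Real.arctan (s - a)) s| ≤ 1 / 2 := fun s => by
    rw [deriv_mul_arctan_sub]
    exact (abs_mul_one_div_le _ _).trans ht
  have hi := integrableOn_coord_weight hFv i a
  have h1 : IntegrableOn (fun _ => (1 : ℝ)) F := integrableOn_const hFv
  have h2 := setIntegral_image_stretch i hθ hb hF (fun _ => 1)
  have h3 := (integrableOn_image_stretch i hθ hb hF (g := fun _ => 1)).2 (by
    simp_rw [deriv_mul_arctan_sub, mul_one]
    exact h1.add (hi.const_mul t))
  simp_rw [deriv_mul_arctan_sub, mul_one] at h2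
  rw [integral_add h1 (hi.const_mul t), integral_const_mul, setIntegral_const, setIntegral_const,
    smul_eq_mul, smul_eq_mul, mul_one, mul_one] at h2
  refine ⟨?_, h2⟩
  rw [integrableOn_const_iff (by simp)] at h3
  exact (h3.resolve_left (by simp)).ne

theorem mul_measureReal_le_integral_weight {F : Set (EuclideanSpace ℝ (Fin N))}
    (hFv : volume F ≠ ∞) (i : Fin N) (x₀ : EuclideanSpace ℝ (Fin N)) (r : ℝ) :
    1 / (1 + r ^ 2) * volume.real (F ∩ Metric.ball x₀ r) ≤
      ∫ x in F, 1 / (1 + (x i - x₀ i) ^ 2) := by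
  have hi := integrableOn_coord_weight hFv i (x₀ i)
  have hfin : volume (F ∩ Metric.ball x₀ r) ≠ ∞ := measure_ne_top_of_subset inter_subset_left hFv
  calc 1 / (1 + r ^ 2) * volume.real (F ∩ Metric.ball x₀ r)
      = ∫ x in F ∩ Metric.ball x₀ r, 1 / (1 + r ^ 2) := by
        rw [setIntegral_const, smul_eq_mul, mul_comm]
    _ ≤ ∫ x in F ∩ Metric.ball x₀ r, 1 / (1 + (x i - x₀ i) ^ 2) := by
        refine integral_mono_ae (integrableOn_const hfin) (hi.mono_set inter_subset_left) ?_
        have : ∀ᵐ x ∂volume.restrict (F ∩ Metric.ball x₀ r), x ∈ Metric.ball x₀ r :=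
          ae_mono (Measure.restrict_mono inter_subset_right le_rfl)
            (ae_restrict_mem Metric.isOpen_ball.measurableSet)
        filter_upwards [this] with x hx
        have h1 : |x i - x₀ i| ≤ r := by
          have := PiLp.norm_apply_le (x - x₀) i
          rw [← dist_eq_norm] at this
          exact this.trans (Metric.mem_ball.1 hx).le
        have h2 : (x i - x₀ i) ^ 2 ≤ r ^ 2 := sq_le_sq' (by linarith [(abs_le.1 h1).1])
          (abs_le.1 h1).2
        exact one_div_le_one_div_of_le (by positivity) (by linarith)
    _ ≤ _ := setIntegral_mono_set hi (.of_forall fun x => by positivity)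
        (LE.le.eventuallyLE inter_subset_left)

theorem integral_weight_le {F : Set (EuclideanSpace ℝ (Fin N))}
    (hFv : volume F ≠ ∞) (i : Fin N) (a : ℝ) :
    ∫ x in F, 1 / (1 + (x i - a) ^ 2) ≤ volume.real F := by
  have := integral_mono (integrableOn_coord_weight hFv i a)
    (integrableOn_const (C := (1 : ℝ)) hFv) fun x => one_div_one_add_sq_le_one (x i - a)
  rwa [setIntegral_const, smul_eq_mul, mul_one] at this

/-- Stretching or squeezing a set near a ball of high density changes its volume to first order,
at a controlled cost. -/
theorem exists_lt_penalizedEnergy {E F : Set (EuclideanSpace ℝ (Fin N))} (hE0 : E.Nonempty)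
    (hE1 : E ≠ univ) (hE : NullMeasurableSet E volume) {ρ : ℝ} (hρ0 : 0 ≤ ρ)
    (hρ : ∀ x ∈ E, Metric.infDist x (frontier E) ≤ ρ) (hdE : depthIntegral E ≠ ∞) (i : Fin N)
    {m M τ Λ r : ℝ} (hm : 0 < m) (hτ : 0 < τ) (hΛ : 0 < Λ) (hr : 0 < r)
    (hrM : 2 * r * M < m / 2) (hF : MeasurableSet F) (hFv : volume F ≠ ∞)
    (hFm : |volume.real F - m| ≤ m / 2) (hne : volume.real F ≠ m)
    (hP : perimeter F ≠ ∞) (hPM : (perimeter F).toReal ≤ M)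
    (hD : dissipation F E ≠ ∞) (hDM : (dissipation F E).toReal ≤ τ * M)
    (hbig : 2 * M + 1 / τ * (12 * m + τ * M + 2 * ρ * m) <
      Λ * (1 / (1 + r ^ 2) *
        (volume.real (Metric.ball (0 : EuclideanSpace ℝ (Fin N)) r) / 2))) :
    ∃ G, MeasurableSet G ∧ penalizedEnergy m τ Λ E G < penalizedEnergy m τ Λ E F := by
  have hFm' := abs_le.1 hFm
  obtain ⟨x₀, hx₀⟩ := exists_ball_half_le hF hFv hP hr (by
    have := mul_le_mul_of_nonneg_left hPM (by positivity : 0 ≤ 2 * r)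
    linarith)
  set v := volume.real F with hv
  set W := ∫ x in F, 1 / (1 + (x i - x₀ i) ^ 2) with hW
  have hW1 : W ≤ v := integral_weight_le hFv i (x₀ i)
  have hW0 := (mul_le_mul_of_nonneg_left hx₀ (by positivity : 0 ≤ 1 / (1 + r ^ 2))).trans
    (mul_measureReal_le_integral_weight hFv i x₀ r)
  rw [← hW] at hW0
  have hv0 : 0 < v := by linarith
  have hd : 0 < |v - m| := abs_pos.2 (sub_ne_zero.2 hne)
  obtain ⟨δ, hδ0, hδ1, hδv⟩ : ∃ δ : ℝ, 0 < δ ∧ δ ≤ 1 / 2 ∧ δ * v ≤ |v - m| :=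
    ⟨min (1 / 2) (|v - m| / v), lt_min (by norm_num) (by positivity), min_le_left _ _,
      (le_div_iff₀ hv0).1 (min_le_right _ _)⟩
  have hWnn : 0 ≤ W := integral_nonneg fun x => by positivity
  obtain ⟨t, ht, htm⟩ : ∃ t : ℝ, |t| = δ ∧ |v + t * W - m| = |v - m| - δ * W := by
    have hδW : δ * W ≤ |v - m| := (mul_le_mul_of_nonneg_left hW1 hδ0.le).trans hδv
    rcases le_total m v with h | h
    · rw [abs_of_nonneg (sub_nonneg.2 h)] at hδW ⊢
      refine ⟨-δ, by rw [abs_neg, abs_of_pos hδ0], ?_⟩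
      rw [abs_of_nonneg (by linarith)]
      ring
    · rw [abs_of_nonpos (sub_nonpos.2 h)] at hδW ⊢
      refine ⟨δ, abs_of_pos hδ0, ?_⟩
      rw [abs_of_nonpos (by linarith)]
      ring
  have hκ : |t| ≤ 1 / 2 := ht.trans_le hδ1
  set θ : ℝ → ℝ := fun s => t * Real.arctan (s - x₀ i) with hθ
  have hθ2 : ContDiff ℝ 2 θ :=
    contDiff_const.mul (Real.contDiff_arctan.comp (contDiff_id.sub contDiff_const))
  have hb : ∀ s, |deriv θ s| ≤ |t| := fun s => by
    rw [hθ, deriv_mul_arctan_sub]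
    exact abs_mul_one_div_le _ _
  have hC : ∀ s, |θ s| ≤ 2 * |t| := fun s => abs_mul_arctan_le _ _
  have hGP := perimeter_image_stretch_le i hθ2 hκ hb hC hF hP
  obtain ⟨hGv, hGm⟩ := volume_image_stretch hF hFv i (x₀ i) hκ
  obtain ⟨hGD, hGD'⟩ := dissipation_image_stretch_le hE0 hE1 hE hF hFv hρ hdE hD i
    (hθ2.of_le one_le_two) hκ hb hC
  have hGP' := ENNReal.toReal_le_of_le_ofReal (by positivity) hGP
  refine ⟨stretch i θ '' F, measurableSet_image_stretch i (hθ2.differentiable two_ne_zero)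
    (fun s => (hb s).trans hκ) hF, ?_⟩
  rw [penalizedEnergy_eq_ofReal hm.le hτ hΛ.le hFv hP hD, penalizedEnergy_eq_ofReal hm.le hτ hΛ.le
    hGv (ne_top_of_le_ne_top ENNReal.ofReal_ne_top hGP) hGD]
  rw [ENNReal.ofReal_lt_ofReal_iff (by positivity), hGm, ← hW, ← hv, htm]
  rw [ht] at hGP' hGD'
  rw [← hv, max_eq_left hρ0] at hGD'
  set p := (perimeter F).toReal
  set d := (dissipation F E).toReal
  have hv2 : v ≤ 2 * m := by linarith
  have e1 : 3 * (2 * δ) * v + δ * (d + ρ * v) ≤ δ * (12 * m + τ * M + 2 * ρ * m) := by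
    have : ρ * v ≤ ρ * (2 * m) := mul_le_mul_of_nonneg_left hv2 hρ0
    have : 6 * v + (d + ρ * v) ≤ 12 * m + τ * M + 2 * ρ * m := by linarith
    have := mul_le_mul_of_nonneg_left this hδ0.le
    linarith
  have e2 := mul_le_mul_of_nonneg_left (hGD'.trans (add_le_add_right e1 d))
    (by positivity : 0 ≤ 1 / τ)
  have e3 : Λ * (1 / (1 + r ^ 2) *
      (volume.real (Metric.ball (0 : EuclideanSpace ℝ (Fin N)) r) / 2)) ≤ Λ * W :=
    mul_le_mul_of_nonneg_left hW0 hΛ.le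
  have e4 := mul_lt_mul_of_pos_left (hbig.trans_le e3) hδ0
  have e5 := mul_le_mul_of_nonneg_left hPM hδ0.le
  nlinarith

theorem volume_eq_of_isPenalizedMinimizer {E F : Set (EuclideanSpace ℝ (Fin N))}
    (hE0 : E.Nonempty) (hE1 : E ≠ univ) (hE : NullMeasurableSet E volume) {ρ : ℝ} (hρ0 : 0 ≤ ρ)
    (hρ : ∀ x ∈ E, Metric.infDist x (frontier E) ≤ ρ) (hdE : depthIntegral E ≠ ∞) (i : Fin N)
    {m M τ Λ r : ℝ} (hm : 0 < m) (hM : 0 ≤ M) (hτ : 0 < τ) (hΛ : 0 < Λ) (hr : 0 < r)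
    (hrM : 2 * r * M < m / 2) (hEm : volume E = ENNReal.ofReal m)
    (hEP : perimeter E ≤ ENNReal.ofReal M) (hΛM : M / Λ ≤ m / 2)
    (hbig : 2 * M + 1 / τ * (12 * m + τ * M + 2 * ρ * m) <
      Λ * (1 / (1 + r ^ 2) *
        (volume.real (Metric.ball (0 : EuclideanSpace ℝ (Fin N)) r) / 2)))
    (hF : IsPenalizedMinimizer m τ Λ E F) : volume F = ENNReal.ofReal m := by
  obtain ⟨H, -, hH, hHF⟩ := hF.1.exists_measurable_superset_ae_eq
  have hle : penalizedEnergy m τ Λ E H ≤ ENNReal.ofReal M := by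
    rw [penalizedEnergy_congr hHF]
    refine (hF.2 E hE).trans ?_
    rwa [penalizedEnergy_self τ Λ hEm]
  obtain ⟨⟨hP, hPM⟩, hD, hHv, hHm⟩ := bounds_of_penalizedEnergy_le hm.le hτ hΛ hM hle
  rw [← measure_congr hHF, ← ofReal_measureReal hHv]
  congr 1
  by_contra hne
  obtain ⟨G, hG, hlt⟩ := exists_lt_penalizedEnergy hE0 hE1 hE hρ0 hρ hdE i hm hτ hΛ hr hrM hH hHv
    (hHm.trans hΛM) hne hP hPM (ne_top_of_le_ne_top ENNReal.ofReal_ne_top hD)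
    (ENNReal.toReal_le_of_le_ofReal (by positivity) hD) hbig
  rw [penalizedEnergy_congr hHF] at hlt
  exact absurd (hF.2 G hG.nullMeasurableSet) (not_le.2 hlt)

end PenalizedFlow

theorem proposition2p2 (N : ℕ) (hN : 1 ≤ N) (m M h : ℝ) (hm : 0 < m) (hM : 0 < M) (hh : 0 < h) :
    ∃ Λ₀ : ℝ, 0 < Λ₀ ∧
      ∀ E : Set (EuclideanSpace ℝ (Fin N)),
        NullMeasurableSet E volume → Bornology.IsBounded E →
        volume E = ENNReal.ofReal m → PenalizedFlow.perimeter E ≤ ENNReal.ofReal M →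
        ∀ Λ : ℝ, Λ₀ ≤ Λ →
          (∃ F : Set (EuclideanSpace ℝ (Fin N)), PenalizedFlow.IsPenalizedMinimizer m h Λ E F) ∧
          (∀ F : Set (EuclideanSpace ℝ (Fin N)),
            PenalizedFlow.IsPenalizedMinimizer m h Λ E F → volume F = ENNReal.ofReal m) ∧
          (∀ F : Set (EuclideanSpace ℝ (Fin N)),
            PenalizedFlow.IsConstrainedMinimizer m h E F ↔
              PenalizedFlow.IsPenalizedMinimizer m h Λ E F) := by
  have i : Fin N := ⟨0, hN⟩
  obtain ⟨ρ, hρ0, hρE⟩ := PenalizedFlow.exists_infDist_frontier_le i m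
  set r : ℝ := m / (8 * M) with hr
  have hr0 : 0 < r := by positivity
  have hrM : 2 * r * M < m / 2 := by
    have : 2 * r * M = m / 4 := by
      rw [hr]
      field_simp
      norm_num
    linarith
  set c : ℝ := 1 / (1 + r ^ 2) *
    (volume.real (Metric.ball (0 : EuclideanSpace ℝ (Fin N)) r) / 2) with hc
  have hb0 : 0 < volume.real (Metric.ball (0 : EuclideanSpace ℝ (Fin N)) r) :=
    ENNReal.toReal_pos (Metric.measure_ball_pos _ _ hr0).ne' measure_ball_lt_top.ne
  have hc0 : 0 < c := by positivity
  set K : ℝ := 2 * M + 1 / h * (12 * m + h * M + 2 * ρ * m) with hK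
  have hK0 : 0 < K := by positivity
  refine ⟨2 * M / m + K / c + 1, by positivity, fun E hE hEb hEm hEP Λ hΛ => ?_⟩
  have hMm : 0 < 2 * M / m := by positivity
  have hKc : 0 < K / c := by positivity
  have hΛ0 : 0 < Λ := by linarith
  have hΛM : M / Λ ≤ m / 2 := by
    rw [div_le_iff₀ hΛ0]
    have : 2 * M / m ≤ Λ := by linarith
    rw [div_le_iff₀ hm] at this
    linarith
  have hbig : K < Λ * c := by
    rw [← div_lt_iff₀ hc0]
    linarith
  obtain ⟨hE1, hρ⟩ := hρE E hEm
  have hE0 : E.Nonempty := by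
    refine nonempty_of_measure_ne_zero (μ := volume) ?_
    rw [hEm]
    exact (ENNReal.ofReal_pos.2 hm).ne'
  have hdE : PenalizedFlow.depthIntegral E ≠ ∞ :=
    PenalizedFlow.depthIntegral_ne_top hE (hEm ▸ ENNReal.ofReal_ne_top) hρ
  have hex := PenalizedFlow.exists_isPenalizedMinimizer hE0 hE1 hE hEb hm.le hM.le hh hΛ0 hEm hEP
  have hvol : ∀ F : Set (EuclideanSpace ℝ (Fin N)),
      PenalizedFlow.IsPenalizedMinimizer m h Λ E F → volume F = ENNReal.ofReal m := fun F hF =>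
    PenalizedFlow.volume_eq_of_isPenalizedMinimizer hE0 hE1 hE hρ0.le hρ hdE i hm hM.le hh hΛ0 hr0
      hrM hEm hEP hΛM hbig hF
  have hiff : ∀ F G : Set (EuclideanSpace ℝ (Fin N)), NullMeasurableSet F volume →
      NullMeasurableSet G volume → volume F = ENNReal.ofReal m → volume G = ENNReal.ofReal m →
      (PenalizedFlow.constrainedEnergy h E F ≤ PenalizedFlow.constrainedEnergy h E G ↔
        PenalizedFlow.penalizedEnergy m h Λ E F ≤ PenalizedFlow.penalizedEnergy m h Λ E G) := by
    intro F G hF hG hFm hGm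
    rw [← EReal.coe_ennreal_le_coe_ennreal_iff,
      ← PenalizedFlow.constrainedEnergy_add_depthIntegral hE0 hE1 hE hF hdE hh Λ hFm,
      ← PenalizedFlow.constrainedEnergy_add_depthIntegral hE0 hE1 hE hG hdE hh Λ hGm]
    exact ((EReal.addLECancellable_coe _).add_le_add_iff_right).symm
  refine ⟨hex, hvol, fun F => ⟨fun hF => ?_, fun hF => ?_⟩⟩
  · obtain ⟨G, hG⟩ := hex
    have hGm := hvol G hG
    exact ⟨hF.1, fun H hH =>
      ((hiff F G hF.1 hG.1 hF.2.1 hGm).1 (hF.2.2 G hG.1 hGm)).trans (hG.2 H hH)⟩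
  · exact ⟨hF.1, hvol F hF, fun G hG hGm =>
      (hiff F G hF.1 hG (hvol F hF) hGm).2 (hF.2 G hG)⟩
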